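/- Consider $n$ agents and $n$ objects, each agent having a strict preference order over the objects; two agents are of the same type if their orders are identical. A random assignment is a doubly stochastic $n\times n$ matrix $p=(p(i)(o))$; a deterministic assignment is a permutation matrix; it is Pareto optimal if no other deterministic assignment is weakly better for all agents and strictly better for some agent. A random assignment $p$ is robust ex post efficient if in every decomposition $p=\sum_{j}\lambda_jP_j$ with $\lambda_j\in(0,1]$, $\sum_j\lambda_j=1$ and permutation matrices $P_j$, all $P_j$ are Pareto optimal. A trading cycle consistent with $p$ is a cycle $o_0\to a_0\to o_1\to a_1\to\dots\to o_{m}\to a_{m}\to o_0$ of distinct objects $o_j$ and distinct agents $a_j$ such that $p(a_j)(o_j)>0$ and $a_j$ strictly prefers $o_{j+1}$ to $o_j$ for all $j$ (indices modulo $m+1$); it is short if it contains at most one agent of each type. Theorem. Let $k$ be a constant. (1) Restricted to instances with at most $k$ agent types, the problem of deciding, given the preference lists and a random assignment $p$ with rational entries (numerators and denominators in binary), whether $p$ is robust ex post efficient, is solvable in polynomial time: there are an algorithm (a random access machine program with addition and subtraction, each instruction counting as one step) and a polynomial, both depending only on $k$, such that on every such instance the algorithm halts with the correct answer within a number of steps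 bounded by the polynomial in the binary length of the input. (2) For all preferences and every random assignment $p$, $p$ is robust ex post efficient if and only if there is no short trading cycle consistent with $p$ such that the agents outside the cycle can be perfectly matched to the objects outside the cycle along pairs $(i,o)$ with $p(i)(o)>0$. (3) If there are at most $k$ agent types, the number of short trading cycles consistent with $p$ is $O(n^{2k})$, with a constant depending only on $k$. -/

import Mathlib

/-!  ## The assignment setting

There are `n` agents and `n` objects, both indexed by `Fin n`. A strict preference of an agent is
the list of all objects from best to worst, that is, a permutation of `Fin n` sending a position
(`0` is the best one) to the object in that position. -/

/-- A profile of strict preferences: `pref i r` is the object in position `r` of the list of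
agent `i` (position `0` is the most preferred one). -/
abbrev Profile (n : ℕ) : Type := Fin n → Equiv.Perm (Fin n)

namespace Profile

variable {n : ℕ}

/-- Agent `i` strictly prefers object `a` to object `b`. -/
def Strict (pref : Profile n) (i a b : Fin n) : Prop :=
  (pref i).symm a < (pref i).symm b

/-- Agent `i` values object `a` at least as much as object `b`. -/
def Weak (pref : Profile n) (i a b : Fin n) : Prop :=
  ¬ pref.Strict i b a

/-- The number of agent types, two agents being of the same type if their preferences are
identical: the number of distinct preferences in the profile. -/
def numTypes (pref : Profile n) : ℕ :=
  (Finset.univ.image pref).card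

/-- A deterministic assignment is a permutation `d` (agent `i` receives object `d i`). It is Pareto
optimal if no deterministic assignment is weakly better for all agents and strictly better for
some agent. -/
def ParetoOptimal (pref : Profile n) (d : Equiv.Perm (Fin n)) : Prop :=
  ¬ ∃ e : Equiv.Perm (Fin n),
    (∀ i, pref.Weak i (e i) (d i)) ∧ ∃ i, pref.Strict i (e i) (d i)

end Profile

/-- A decomposition of a matrix `p` into permutation matrices: `p = ∑ j, weight j • P j` where
the weights lie in `(0, 1]` and sum to `1`, and `P j` is the matrix of the deterministic
assignment `assign j` (a `1` in row `i` and column `assign j i`). -/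
structure Decomposition {n : ℕ} (p : Matrix (Fin n) (Fin n) ℝ) where
  /-- the number of summands -/
  len : ℕ
  /-- the weights -/
  weight : Fin len → ℝ
  /-- the deterministic assignments -/
  assign : Fin len → Equiv.Perm (Fin n)
  weight_pos : ∀ j, 0 < weight j
  weight_le_one : ∀ j, weight j ≤ 1
  weight_sum : ∑ j, weight j = 1
  eq_sum : p = ∑ j, weight j • (assign j).permMatrix ℝ

/-- A random assignment is robust ex post efficient if every decomposition of it consists of
Pareto optimal deterministic assignments. -/
def RobustExPostEfficient {n : ℕ} (pref : Profile n) (p : Matrix (Fin n) (Fin n) ℝ) : Prop :=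
  ∀ D : Decomposition p, ∀ j, pref.ParetoOptimal (D.assign j)

/-- A trading cycle consistent with `p`:
`object 0 → agent 0 → object 1 → agent 1 → ⋯ → object len → agent len → object 0`,
where an object can point to an agent who receives it with positive probability, and an agent
points to an object strictly preferred to the one pointing to him. The addition in `Fin (len + 1)`
is cyclic. -/
structure TradingCycle {n : ℕ} (pref : Profile n) (p : Matrix (Fin n) (Fin n) ℝ) where
  /-- the number of agents in the cycle, minus one -/
  len : ℕ
  /-- the agents of the cycle -/
  agent : Fin (len + 1) → Fin n
  /-- the objects of the cycle -/
  object : Fin (len + 1) → Fin n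
  agent_injective : Function.Injective agent
  object_injective : Function.Injective object
  consistent : ∀ j, 0 < p (agent j) (object j)
  improves : ∀ j, pref.Strict (agent j) (object (j + 1)) (object j)

namespace TradingCycle

variable {n : ℕ} {pref : Profile n} {p : Matrix (Fin n) (Fin n) ℝ}

/-- A trading cycle is short if it contains at most one agent of each type. -/
def Short (c : TradingCycle pref p) : Prop :=
  ∀ j l, pref (c.agent j) = pref (c.agent l) → j = l

/-- The agents outside the cycle can be perfectly matched to the objects outside the cycle within
the support of `p`. -/
def RestMatchable (c : TradingCycle pref p) : Prop :=
  ∃ m : {i : Fin n // i ∉ Set.range c.agent} ≃ {o : Fin n // o ∉ Set.range c.object},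
    ∀ i, 0 < p i.1 (m i).1

end TradingCycle

/-! ## Random access machines

Programs of a random access machine with natural-number registers and a memory of natural numbers
with indirect addressing, in structured form. The arithmetic is addition and truncated
subtraction (there is no multiplication), so that `t` steps produce numbers at most `t` bits
longer than the numbers at the start, and polynomial time under the unit cost measure used here is
polynomial time on Turing machines. -/

/-- Programs. Registers are numbered by natural numbers. -/
inductive RAMProgram : Type
  /-- do nothing -/
  | skip : RAMProgram
  /-- `x := c` for a constant `c` -/
  | const (x c : ℕ) : RAMProgram
  /-- `x := y` -/
  | copy (x y : ℕ) : RAMProgram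
  /-- `x := y + z` -/
  | add (x y z : ℕ) : RAMProgram
  /-- `x := max (y - z) 0` -/
  | sub (x y z : ℕ) : RAMProgram
  /-- `x := memory[y]` -/
  | load (x y : ℕ) : RAMProgram
  /-- `memory[x] := y` -/
  | store (x y : ℕ) : RAMProgram
  /-- first `c`, then `d` -/
  | seq (c d : RAMProgram) : RAMProgram
  /-- `c` if register `x` is nonzero, and `d` if it is zero -/
  | cond (x : ℕ) (c d : RAMProgram) : RAMProgram
  /-- repeat `c` as long as register `x` is nonzero -/
  | loop (x : ℕ) (c : RAMProgram) : RAMProgram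

/-- The contents of the registers and of the memory. -/
structure RAMState where
  /-- the registers -/
  reg : ℕ → ℕ
  /-- the memory -/
  mem : ℕ → ℕ

namespace RAMState

/-- Write the value `v` to register `x`. -/
def setReg (s : RAMState) (x v : ℕ) : RAMState :=
  { s with reg := Function.update s.reg x v }

/-- Write the value `v` to the memory cell with address `a`. -/
def setMem (s : RAMState) (a v : ℕ) : RAMState :=
  { s with mem := Function.update s.mem a v }

/-- The initial state: the input in the memory from address `0` on, its length in register `0`,
and `0` everywhere else. -/
def init (input : List ℕ) : RAMState where
  reg := fun x => if x = 0 then input.length else 0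
  mem := fun a => input.getD a 0

end RAMState

/-- `Exec c s s' t`: started in the state `s`, the program `c` halts in the state `s'` after exactly
`t` steps. Each elementary instruction and each test of a register is one step. -/
inductive Exec : RAMProgram → RAMState → RAMState → ℕ → Prop
  | skip (s : RAMState) : Exec .skip s s 1
  | const (s : RAMState) (x c : ℕ) : Exec (.const x c) s (s.setReg x c) 1
  | copy (s : RAMState) (x y : ℕ) : Exec (.copy x y) s (s.setReg x (s.reg y)) 1
  | add (s : RAMState) (x y z : ℕ) :
      Exec (.add x y z) s (s.setReg x (s.reg y + s.reg z)) 1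
  | sub (s : RAMState) (x y z : ℕ) :
      Exec (.sub x y z) s (s.setReg x (s.reg y - s.reg z)) 1
  | load (s : RAMState) (x y : ℕ) : Exec (.load x y) s (s.setReg x (s.mem (s.reg y))) 1
  | store (s : RAMState) (x y : ℕ) : Exec (.store x y) s (s.setMem (s.reg x) (s.reg y)) 1
  | seq {c d : RAMProgram} {s s₁ s₂ : RAMState} {t₁ t₂ : ℕ} :
      Exec c s s₁ t₁ → Exec d s₁ s₂ t₂ → Exec (.seq c d) s s₂ (t₁ + t₂)
  | cond_nonzero {x : ℕ} {c d : RAMProgram} {s s₁ : RAMState} {t : ℕ} :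
      s.reg x ≠ 0 → Exec c s s₁ t → Exec (.cond x c d) s s₁ (t + 1)
  | cond_zero {x : ℕ} {c d : RAMProgram} {s s₁ : RAMState} {t : ℕ} :
      s.reg x = 0 → Exec d s s₁ t → Exec (.cond x c d) s s₁ (t + 1)
  | loop_nonzero {x : ℕ} {c : RAMProgram} {s s₁ s₂ : RAMState} {t₁ t₂ : ℕ} :
      s.reg x ≠ 0 → Exec c s s₁ t₁ → Exec (.loop x c) s₁ s₂ t₂ →
      Exec (.loop x c) s s₂ (t₁ + t₂ + 1)
  | loop_zero {x : ℕ} {c : RAMProgram} {s : RAMState} :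
      s.reg x = 0 → Exec (.loop x c) s s 1

/-- The size of an input: its total length in binary notation, with one separator per number. -/
def inputSize (input : List ℕ) : ℕ :=
  (input.map fun x => x.size + 1).sum

/-- The property `P` of the objects in `α`, given to a machine through the encoding `enc`, is
decidable in polynomial time: one program halts on all inputs within a number of steps that is
polynomial in the input size, leaving `1` in register `0` if `P` holds, and `0` otherwise. -/
def DecidableInPolyTime {α : Type} (enc : α → List ℕ) (P : α → Prop) : Prop :=
  ∃ (c : RAMProgram) (q : Polynomial ℕ), ∀ a : α, ∃ (s : RAMState) (t : ℕ),
    Exec c (RAMState.init (enc a)) s t ∧ t ≤ q.eval (inputSize (enc a)) ∧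
      (P a → s.reg 0 = 1) ∧ (¬ P a → s.reg 0 = 0)

/-! ## The decision problem -/

/-- An instance of the problem: a profile of strict preferences and a random assignment with
rational entries, that is, a doubly stochastic matrix. -/
structure AssignmentInstance : Type where
  /-- the number of agents, and of objects -/
  n : ℕ
  /-- the preferences -/
  pref : Profile n
  /-- the random assignment -/
  p : Matrix (Fin n) (Fin n) ℚ
  p_mem : p ∈ doublyStochastic ℚ (Fin n)

namespace AssignmentInstance

/-- The matrix of the random assignment, as a real matrix. -/
def realMatrix (I : AssignmentInstance) : Matrix (Fin I.n) (Fin I.n) ℝ :=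
  I.p.map fun x : ℚ => (x : ℝ)

/-- The input of the machine: the number `n`, then the preference lists of the agents (each from
best to worst), then the rows of the matrix, each entry given by its numerator and its
denominator. -/
def encode (I : AssignmentInstance) : List ℕ :=
  I.n ::
    ((List.finRange I.n).flatMap fun i => (List.finRange I.n).map fun r => (I.pref i r : ℕ)) ++
    ((List.finRange I.n).flatMap fun i => (List.finRange I.n).flatMap fun o =>
      [(I.p i o).num.natAbs, (I.p i o).den])

end AssignmentInstance

/-! An assignment is Pareto optimal unless some cycle of agents, each envying the object of the
next one, can trade. A shortest envy cycle visits every type at most once: of two visited agents of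
one type, the worse off envies the successor of the other, which gives a shortcut. By Birkhoff's
theorem, the assignments occurring in the decompositions of `p` are exactly those in the support
of `p`, so `p` fails to be robust ex post efficient iff some assignment in its support has an envy
cycle that is injective on types. With at most `k` types, such a cycle and the objects of its agents
are two sequences of length at most `k`, which leaves `k * n ^ (2 * k)` cases.

In each case a perfect matching in a bipartite graph is sought. An ascending auction finds one in
polynomial time with additions and comparisons only: an agent without an object bids for a
compatible object of least price and raises that price by one. If there is a perfect matching, no
price exceeds `n`, so that the bidding stops with every agent served. -/

namespace Profile

variable {n m : ℕ} {pref : Profile n} {d : Equiv.Perm (Fin n)} {w : Fin (m + 1) → Fin n}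

/-- Under the assignment `d`, agent `a` envies agent `b`: he strictly prefers the object of `b` to
his own. -/
def Envies (pref : Profile n) (d : Equiv.Perm (Fin n)) (a b : Fin n) : Prop :=
  pref.Strict a (d b) (d a)

/-- A cycle of agents, each envying the next one; agents may occur repeatedly. The addition in
`Fin (m + 1)` is cyclic. -/
def IsEnvyCycle (pref : Profile n) (d : Equiv.Perm (Fin n)) (w : Fin (m + 1) → Fin n) : Prop :=
  ∀ j, pref.Envies d (w j) (w (j + 1))

theorem Envies.of_pref_eq {a a' b : Fin n} (h : pref.Envies d a b) (hpref : pref a = pref a')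
    (hle : (pref a).symm (d a) ≤ (pref a).symm (d a')) : pref.Envies d a' b := by
  unfold Envies Strict at *
  rw [← hpref]
  exact h.trans_le hle

theorem IsEnvyCycle.exists_shortcut (hw : pref.IsEnvyCycle d w) {i j : Fin (m + 1)} (hij : i ≠ j)
    (h : pref.Envies d (w j) (w (i + 1))) :
    ∃ e < m, ∃ w' : Fin (e + 1) → Fin n, pref.IsEnvyCycle d w' := by
  set e := j - i - 1
  have he : e ≠ Fin.last m := fun he =>
    hij (sub_eq_zero.mp ((sub_eq_iff_eq_add.mp he).trans (Fin.last_add_one m))).symm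
  refine ⟨e, Fin.val_lt_last he, fun x => w (i + 1 + Fin.castLE e.2 x), fun x => ?_⟩
  rcases eq_or_ne x (Fin.last e) with rfl | hx
  · have hend : i + 1 + Fin.castLE e.2 (Fin.last e) = j := by
      rw [show Fin.castLE e.2 (Fin.last e) = e from rfl]
      simp only [e]
      abel
    simpa only [hend, Fin.last_add_one, Fin.castLE_zero, add_zero] using h
  · have hsucc : Fin.castLE e.2 (x + 1) = Fin.castLE e.2 x + 1 := by
      have hlt := Fin.val_lt_last hx
      have hlt' : Fin.castLE e.2 x < Fin.last m := lt_of_lt_of_le (b := e) hlt (Fin.le_last e)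
      ext
      rw [Fin.val_castLE, Fin.val_add_one_of_lt hlt, Fin.val_add_one_of_lt hlt', Fin.val_castLE]
    simpa only [hsucc, add_assoc] using hw (i + 1 + Fin.castLE e.2 x)

theorem IsEnvyCycle.exists_injective (hw : pref.IsEnvyCycle d w) :
    ∃ (l : ℕ) (v : Fin (l + 1) → Fin n),
      pref.IsEnvyCycle d v ∧ Function.Injective fun j => pref (v j) := by
  classical
  have hex : ∃ l, ∃ v : Fin (l + 1) → Fin n, pref.IsEnvyCycle d v := ⟨m, w, hw⟩
  obtain ⟨v, hv⟩ := Nat.find_spec hex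
  have hmin : ∀ i j, i ≠ j → ¬ pref.Envies d (v j) (v (i + 1)) := fun i j hij h =>
    have ⟨_, he, hcycle⟩ := hv.exists_shortcut hij h
    Nat.find_min hex he hcycle
  refine ⟨_, v, hv, fun i j (hpref : pref (v i) = pref (v j)) => by_contra fun hij => ?_⟩
  rcases le_total ((pref (v i)).symm (d (v i))) ((pref (v i)).symm (d (v j))) with h | h
  · exact hmin i j hij ((hv i).of_pref_eq hpref h)
  · exact hmin j i (Ne.symm hij) ((hv j).of_pref_eq hpref.symm (hpref ▸ h))

theorem exists_isEnvyCycle_of_not_paretoOptimal (h : ¬ pref.ParetoOptimal d) :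
    ∃ (m : ℕ) (w : Fin (m + 1) → Fin n), pref.IsEnvyCycle d w := by
  obtain ⟨e, hweak, i, hi⟩ := not_not.mp h
  set τ : Equiv.Perm (Fin n) := d⁻¹ * e
  have hd : ∀ a, d (τ a) = e a := fun a => by simp [τ]
  have henvies : ∀ a, τ a ≠ a → pref.Envies d a (τ a) := fun a ha => by
    refine lt_of_le_of_ne (not_lt.mp (hd a ▸ hweak a)) fun heq => ha ?_
    exact d.injective ((pref a).symm.injective heq)
  have hmoves : τ i ≠ i := fun heq => by
    rw [← hd, heq] at hi
    exact lt_irrefl _ hi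
  obtain ⟨m, hm⟩ := Nat.exists_eq_add_one.mpr (orderOf_pos τ)
  refine ⟨m, fun j => (τ ^ (j : ℕ)) i, fun j => ?_⟩
  have hnext : (τ ^ ((j + 1 : Fin (m + 1)) : ℕ)) i = τ ((τ ^ (j : ℕ)) i) := by
    rw [← Equiv.Perm.mul_apply, ← pow_succ', Fin.val_add, Fin.val_one', Nat.add_mod_mod,
      ← pow_eq_pow_mod _ (hm ▸ pow_orderOf_eq_one τ)]
  beta_reduce
  rw [hnext]
  exact henvies _ fun heq => hmoves ((τ ^ (j : ℕ)).injective (by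
    rwa [← Equiv.Perm.mul_apply, ← pow_succ, pow_succ', Equiv.Perm.mul_apply]))

theorem IsEnvyCycle.not_paretoOptimal (henvy : pref.IsEnvyCycle d w)
    (hw : Function.Injective w) : ¬ pref.ParetoOptimal d := by
  classical
  set c : Equiv.Perm (Fin n) := (finRotate (m + 1)).extendDomain (Equiv.ofInjective w hw)
  have hcycle : ∀ j, c (w j) = w (j + 1) := fun j => by
    simpa [c] using
      Equiv.Perm.extendDomain_apply_image (finRotate (m + 1)) (Equiv.ofInjective w hw) j
  refine not_not.mpr ⟨d * c, fun a => ?_, w 0, ?_⟩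
  · by_cases ha : a ∈ Set.range w
    · obtain ⟨j, rfl⟩ := ha
      rw [Equiv.Perm.mul_apply, hcycle]
      exact (henvy j).le.not_gt
    · rw [Equiv.Perm.mul_apply, Equiv.Perm.extendDomain_apply_not_subtype _ _ ha]
      exact lt_irrefl _
  · rw [Equiv.Perm.mul_apply, hcycle]
    exact henvy 0

theorem not_paretoOptimal_iff : ¬ pref.ParetoOptimal d ↔
    ∃ (m : ℕ) (w : Fin (m + 1) → Fin n),
      pref.IsEnvyCycle d w ∧ Function.Injective fun j => pref (w j) := by
  constructor
  · intro h
    obtain ⟨m, w, hw⟩ := exists_isEnvyCycle_of_not_paretoOptimal h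
    exact hw.exists_injective
  · rintro ⟨m, w, hw, hinj⟩
    exact hw.not_paretoOptimal (Function.Injective.of_comp hinj)

theorem card_le_numTypes {ι : Type*} [Fintype ι] {f : ι → Fin n}
    (hf : Function.Injective fun j => pref (f j)) : Fintype.card ι ≤ pref.numTypes :=
  Finset.card_le_card_of_injOn (fun j => pref (f j)) (fun j _ => by simp) hf.injOn

theorem not_paretoOptimal_iff_of_numTypes_le {k : ℕ} (hk : pref.numTypes ≤ k) :
    ¬ pref.ParetoOptimal d ↔
      ∃ m < k, ∃ w : Fin (m + 1) → Fin n, pref.IsEnvyCycle d w := by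
  constructor
  · intro h
    obtain ⟨m, w, hw, hinj⟩ := not_paretoOptimal_iff.mp h
    have hcard := card_le_numTypes hinj
    rw [Fintype.card_fin] at hcard
    exact ⟨m, hcard.trans hk, w, hw⟩
  · rintro ⟨m, -, w, hw⟩
    exact not_paretoOptimal_iff.mpr ⟨_, hw.exists_injective.choose_spec⟩

end Profile

theorem exists_weights_of_mem_doublyStochastic {ι R : Type*} [Fintype ι] [DecidableEq ι]
    [Field R] [LinearOrder R] [IsStrictOrderedRing R] {p : Matrix ι ι R}
    (hp : p ∈ doublyStochastic R ι) {d : Equiv.Perm ι} (hd : ∀ i, 0 < p i (d i)) :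
    ∃ v : Equiv.Perm ι → R, (∀ σ, 0 ≤ v σ) ∧ 0 < v d ∧ ∑ σ, v σ = 1 ∧
      ∑ σ, v σ • σ.permMatrix R = p := by
  obtain ⟨ε, hε, hε_one, hε_le⟩ : ∃ ε : R, 0 < ε ∧ ε ≤ 1 ∧ ∀ i, ε ≤ p i (d i) := by
    let f : Option ι → R := fun x => x.elim 1 fun i => p i (d i)
    obtain ⟨x, hx⟩ := Finite.exists_min f
    refine ⟨f x, ?_, hx none, fun i => hx (some i)⟩
    cases x with
    | none => exact one_pos
    | some i => exact hd i
  have hP := permMatrix_mem_doublyStochastic (R := R) (σ := d)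
  -- Splitting off `ε` times the permutation matrix of `d` leaves a multiple of a doubly
  -- stochastic matrix, to which Birkhoff's theorem applies.
  obtain ⟨q, hq, hpq⟩ :
      ∃ q ∈ doublyStochastic R ι, p - ε • d.permMatrix R = (1 - ε) • q := by
    rw [exists_mem_doublyStochastic_eq_smul_iff (sub_nonneg.mpr hε_one)]
    rw [mem_doublyStochastic_iff_sum] at hp hP
    refine ⟨fun i o => ?_, fun i => ?_, fun o => ?_⟩
    · rw [Matrix.sub_apply, Matrix.smul_apply, sub_nonneg]
      by_cases h : d i = o
      · simpa [Equiv.Perm.permMatrix, PEquiv.toMatrix_apply, h] using h ▸ hε_le i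
      · simpa [Equiv.Perm.permMatrix, PEquiv.toMatrix_apply, h] using hp.1 i o
    · simp only [Matrix.sub_apply, Matrix.smul_apply, smul_eq_mul, ← Finset.mul_sum,
        Finset.sum_sub_distrib, hp.2.1, hP.2.1, mul_one]
    · simp only [Matrix.sub_apply, Matrix.smul_apply, smul_eq_mul, ← Finset.mul_sum,
        Finset.sum_sub_distrib, hp.2.2, hP.2.2, mul_one]
  obtain ⟨u, hu, hu_sum, rfl⟩ := exists_eq_sum_perm_of_mem_doublyStochastic hq
  have hu' : ∀ σ, 0 ≤ (1 - ε) * u σ := fun σ => mul_nonneg (sub_nonneg.mpr hε_one) (hu σ)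
  refine ⟨fun σ => (1 - ε) * u σ + if σ = d then ε else 0, fun σ => ?_, ?_, ?_, ?_⟩
  · exact add_nonneg (hu' σ) (by split_ifs <;> simp [hε.le])
  · simpa using add_pos_of_nonneg_of_pos (hu' d) hε
  · simp [Finset.sum_add_distrib, ← Finset.mul_sum, hu_sum]
  · simp only [add_smul, mul_smul, Finset.sum_add_distrib, ← Finset.smul_sum, ← hpq, ite_smul,
      zero_smul, Finset.sum_ite_eq', Finset.mem_univ, if_true, sub_add_cancel]

section Decomposition

variable {n : ℕ} {p : Matrix (Fin n) (Fin n) ℝ}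

theorem Decomposition.apply_pos (D : Decomposition p) (j : Fin D.len) (i : Fin n) :
    0 < p i (D.assign j i) := by
  have hsum : p i (D.assign j i) =
      ∑ l, D.weight l * if D.assign l i = D.assign j i then 1 else 0 :=
    (congrFun (congrFun D.eq_sum i) _).trans <| by
      simp [Matrix.sum_apply, Equiv.Perm.permMatrix, PEquiv.toMatrix_apply]
  rw [hsum]
  refine Finset.sum_pos' (fun l _ => mul_nonneg (D.weight_pos l).le (by split_ifs <;> simp))
    ⟨j, Finset.mem_univ j, by simpa using D.weight_pos j⟩

theorem exists_decomposition_of_weights {v : Equiv.Perm (Fin n) → ℝ} (hv : ∀ σ, 0 ≤ v σ)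
    (hv_sum : ∑ σ, v σ = 1) (hp : ∑ σ, v σ • σ.permMatrix ℝ = p) {d : Equiv.Perm (Fin n)}
    (hd : 0 < v d) : ∃ (D : Decomposition p) (j : Fin D.len), D.assign j = d := by
  classical
  let e := Fintype.equivFin {σ // 0 < v σ}
  have he : Function.Injective fun j => (e.symm j).1 :=
    Subtype.val_injective.comp e.symm.injective
  have hv_zero : ∀ σ ∉ Set.range fun j => (e.symm j).1, v σ = 0 := fun σ hσ =>
    le_antisymm (not_lt.mp fun hpos => hσ ⟨e ⟨σ, hpos⟩, by simp⟩) (hv σ)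
  refine ⟨⟨_, fun j => v (e.symm j), fun j => e.symm j, fun j => (e.symm j).2, fun j => ?_, ?_, ?_⟩,
    e ⟨d, hd⟩, by simp⟩
  · exact hv_sum ▸ Finset.single_le_sum (fun σ _ => hv σ) (Finset.mem_univ _)
  · exact (Fintype.sum_of_injective _ he _ v hv_zero fun _ => rfl).trans hv_sum
  · exact hp.symm.trans (Fintype.sum_of_injective _ he _ (fun σ => v σ • σ.permMatrix ℝ)
      (fun σ hσ => by rw [hv_zero σ hσ, zero_smul]) fun _ => rfl).symm

theorem exists_decomposition (hp : p ∈ doublyStochastic ℝ (Fin n)) {d : Equiv.Perm (Fin n)}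
    (hd : ∀ i, 0 < p i (d i)) : ∃ (D : Decomposition p) (j : Fin D.len), D.assign j = d :=
  have ⟨_, hv, hvd, hv_sum, hvp⟩ := exists_weights_of_mem_doublyStochastic hp hd
  exists_decomposition_of_weights hv hv_sum hvp hvd

theorem not_robustExPostEfficient_iff {pref : Profile n} (hp : p ∈ doublyStochastic ℝ (Fin n)) :
    ¬ RobustExPostEfficient pref p ↔
      ∃ d : Equiv.Perm (Fin n), (∀ i, 0 < p i (d i)) ∧ ¬ pref.ParetoOptimal d := by
  constructor
  · intro h
    simp only [RobustExPostEfficient, not_forall] at h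
    obtain ⟨D, j, h⟩ := h
    exact ⟨D.assign j, D.apply_pos j, h⟩
  · rintro ⟨d, hd, h⟩ hr
    obtain ⟨D, j, rfl⟩ := exists_decomposition hp hd
    exact h (hr D j)

end Decomposition

theorem exists_perm_of_equiv_compl_range {ι α : Type*} {a o : ι → α} (ha : Function.Injective a)
    (ho : Function.Injective o) (m : {i // i ∉ Set.range a} ≃ {x // x ∉ Set.range o}) :
    ∃ d : Equiv.Perm α, (∀ j, d (a j) = o j) ∧ ∀ i : {i // i ∉ Set.range a}, d i = m i := by
  classical
  let e : {i // i ∈ Set.range a} ≃ {x // x ∈ Set.range o} :=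
    (Equiv.ofInjective a ha).symm.trans (Equiv.ofInjective o ho)
  have he : ∀ j, e ⟨a j, j, rfl⟩ = ⟨o j, j, rfl⟩ := fun j => by
    simp only [e, Equiv.trans_apply, Equiv.ofInjective_symm_apply]
    rfl
  refine ⟨Equiv.subtypeCongr e m, fun j => ?_, fun i => ?_⟩
  · simp [Equiv.subtypeCongr, Equiv.sumCompl_symm_apply_of_pos (p := (· ∈ Set.range a)) ⟨j, rfl⟩,
      he]
  · simp [Equiv.subtypeCongr, Equiv.sumCompl_symm_apply_of_neg (p := (· ∈ Set.range a)) i.2]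

namespace TradingCycle

variable {n : ℕ} {pref : Profile n} {p : Matrix (Fin n) (Fin n) ℝ}

theorem RestMatchable.exists_perm {c : TradingCycle pref p} (hc : c.RestMatchable) :
    ∃ d : Equiv.Perm (Fin n), (∀ j, d (c.agent j) = c.object j) ∧ ∀ i, 0 < p i (d i) := by
  obtain ⟨m, hm⟩ := hc
  obtain ⟨d, hcycle, hrest⟩ :=
    exists_perm_of_equiv_compl_range c.agent_injective c.object_injective m
  refine ⟨d, hcycle, fun i => ?_⟩
  by_cases hi : i ∈ Set.range c.agent
  · obtain ⟨j, rfl⟩ := hi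
    exact hcycle j ▸ c.consistent j
  · exact hrest ⟨i, hi⟩ ▸ hm ⟨i, hi⟩

theorem exists_short_restMatchable {d : Equiv.Perm (Fin n)} (hd : ∀ i, 0 < p i (d i))
    (h : ¬ pref.ParetoOptimal d) : ∃ c : TradingCycle pref p, c.Short ∧ c.RestMatchable := by
  obtain ⟨m, w, hw, hinj⟩ := Profile.not_paretoOptimal_iff.mp h
  have hwinj : Function.Injective w := Function.Injective.of_comp hinj
  refine ⟨⟨m, w, d ∘ w, hwinj, d.injective.comp hwinj, fun j => hd _, hw⟩,
    fun j l h => hinj h, d.subtypeEquiv fun i => ?_, fun i => hd _⟩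
  simp [Set.range_comp]

theorem Short.len_lt {c : TradingCycle pref p} (hc : c.Short) : c.len < pref.numTypes := by
  simpa using Profile.card_le_numTypes (f := c.agent) fun j l h => hc j l h

theorem encard_short_le {k : ℕ} (h : pref.numTypes ≤ k) :
    {c : TradingCycle pref p | c.Short}.encard ≤ ((k * n ^ (2 * k) : ℕ) : ℕ∞) := by
  let φ : {c : TradingCycle pref p // c.Short} → Fin k × (Fin k → Fin n × Fin n) := fun c =>
    (⟨c.1.len, c.2.len_lt.trans_le h⟩, fun x =>
      (c.1.agent ⟨min x c.1.len, by omega⟩, c.1.object ⟨min x c.1.len, by omega⟩))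
  have hφ : Function.Injective φ := by
    rintro ⟨⟨l, a, o, _, _, _, _⟩, hc⟩ ⟨⟨l', a', o', _, _, _, _⟩, hc'⟩ heq
    simp only [φ, Prod.mk.injEq, Fin.mk.injEq] at heq
    obtain ⟨rfl, heq⟩ := heq
    have hl : l < k := hc.len_lt.trans_le h
    have hvalues : ∀ j : Fin (l + 1), a j = a' j ∧ o j = o' j := fun j => by
      have hj : min (j : ℕ) l = j := by omega
      simpa [hj] using congrFun heq ⟨j, by omega⟩
    obtain rfl : a = a' := funext fun j => (hvalues j).1
    obtain rfl : o = o' := funext fun j => (hvalues j).2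
    rfl
  calc {c : TradingCycle pref p | c.Short}.encard
      ≤ ENat.card (Fin k × (Fin k → Fin n × Fin n)) := ENat.card_le_card_of_injective hφ
    _ = ((k * n ^ (2 * k) : ℕ) : ℕ∞) := by
      rw [ENat.card_eq_coe_fintype_card]
      simp only [Fintype.card_prod, Fintype.card_fin, Fintype.card_fun, ← pow_two, ← pow_mul]

end TradingCycle

section RobustExPostEfficient

variable {n : ℕ} {pref : Profile n} {p : Matrix (Fin n) (Fin n) ℝ}

theorem robustExPostEfficient_iff (hp : p ∈ doublyStochastic ℝ (Fin n)) :
    RobustExPostEfficient pref p ↔ ¬ ∃ c : TradingCycle pref p, c.Short ∧ c.RestMatchable := by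
  rw [← not_iff_not, not_robustExPostEfficient_iff hp, not_not]
  constructor
  · rintro ⟨d, hd, h⟩
    exact TradingCycle.exists_short_restMatchable hd h
  · rintro ⟨c, hshort, hrest⟩
    obtain ⟨d, hcycle, hd⟩ := hrest.exists_perm
    refine ⟨d, hd, Profile.not_paretoOptimal_iff.mpr
      ⟨c.len, c.agent, fun j => ?_, fun j l h => hshort j l h⟩⟩
    rw [Profile.Envies, hcycle, hcycle]
    exact c.improves j

theorem not_robustExPostEfficient_iff_of_numTypes_le (hp : p ∈ doublyStochastic ℝ (Fin n)) {k : ℕ}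
    (hk : pref.numTypes ≤ k) : ¬ RobustExPostEfficient pref p ↔
      ∃ m < k, ∃ a o : Fin (m + 1) → Fin n, (∀ j, pref.Strict (a j) (o (j + 1)) (o j)) ∧
        ∃ d : Equiv.Perm (Fin n), (∀ i, 0 < p i (d i)) ∧ ∀ j, d (a j) = o j := by
  simp only [not_robustExPostEfficient_iff hp, Profile.not_paretoOptimal_iff_of_numTypes_le hk]
  constructor
  · rintro ⟨d, hd, m, hm, w, hw⟩
    exact ⟨m, hm, w, d ∘ w, hw, d, hd, fun _ => rfl⟩
  · rintro ⟨m, hm, a, o, henvy, d, hd, hdo⟩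
    refine ⟨d, hd, m, hm, a, fun j => ?_⟩
    rw [Profile.Envies, hdo, hdo]
    exact henvy j

end RobustExPostEfficient

/-! ## Bipartite matching by auction -/

/-- The prices and the holders of the objects `β` in an auction with bidders `α`. -/
structure AuctionState (α β : Type*) where
  /-- the prices -/
  price : β → ℕ
  /-- the bidder holding each object, if any -/
  holder : β → Option α

namespace AuctionState

variable {α β : Type*} {A : α → β → Prop} {s : AuctionState α β} {i : α} {o : β}

/-- Bidder `i` bids for `o` if he holds nothing and `o` is a cheapest object acceptable to him. -/
def Bids (A : α → β → Prop) (s : AuctionState α β) (i : α) (o : β) : Prop :=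
  (∀ x, s.holder x ≠ some i) ∧ A i o ∧ ∀ x, A i x → s.price o ≤ s.price x

/-- The invariant of the auction. Up to one unit, every holder has a cheapest object acceptable to
him. -/
structure Feasible (A : α → β → Prop) (s : AuctionState α β) : Prop where
  holder_injective : ∀ {x y i}, s.holder x = some i → s.holder y = some i → x = y
  acceptable : ∀ {x i}, s.holder x = some i → A i x
  price_le : ∀ {x i}, s.holder x = some i → ∀ y, A i y → s.price x ≤ s.price y + 1
  price_eq_zero : ∀ {x}, s.holder x = none → s.price x = 0

theorem Feasible.initial : Feasible A ⟨fun _ => 0, fun _ => none⟩ := by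
  constructor <;> simp

-- The injection sends an object of price above `t` to the partner of its holder under `g`, whose
-- price is at least `t`; the partner of the unserved bidder `i` is not in its range.
theorem Feasible.card_price_lt_card [Fintype β] (hs : s.Feasible A) (hb : s.Bids A i o) {g : α → β}
    (hg : Function.Injective g) (hA : ∀ j, A j (g j)) {t : ℕ} (ht : t ≤ s.price o) :
    (Finset.univ.filter fun x => t + 1 ≤ s.price x).card <
      (Finset.univ.filter fun x => t ≤ s.price x).card := by
  have hheld : ∀ x, t + 1 ≤ s.price x → s.holder x = some ((s.holder x).getD i) := fun x hx => by
    cases h : s.holder x with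
    | none => exact absurd (hs.price_eq_zero h) (Nat.ne_zero_of_lt hx)
    | some j => rfl
  have hi : g i ∈ Finset.univ.filter fun x => t ≤ s.price x := by
    simpa using ht.trans (hb.2.2 _ (hA i))
  classical
  refine lt_of_le_of_lt (Finset.card_le_card_of_injOn (fun x => g ((s.holder x).getD i)) ?_ ?_)
    (Finset.card_erase_lt_of_mem hi)
  · intro x hx
    simp only [Finset.coe_filter, Finset.mem_univ, true_and, Set.mem_ofPred_eq] at hx
    have hxi : (s.holder x).getD i ≠ i := fun h => hb.1 x (by rw [hheld x hx, h])
    have hprice := hs.price_le (hheld x hx) _ (hA _)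
    simp only [Finset.coe_erase, Finset.coe_filter, Finset.mem_univ, true_and, Set.mem_sdiff,
      Set.mem_ofPred_eq, Set.mem_singleton_iff]
    exact ⟨by omega, fun h => hxi (hg h)⟩
  · intro x hx y hy hxy
    simp only [Finset.coe_filter, Finset.mem_univ, true_and, Set.mem_ofPred_eq] at hx hy
    exact hs.holder_injective (hheld x hx) (hg hxy ▸ hheld y hy)

theorem Feasible.price_lt_card [Fintype β] (hs : s.Feasible A) (hb : s.Bids A i o) {g : α → β}
    (hg : Function.Injective g) (hA : ∀ j, A j (g j)) : s.price o < Fintype.card β := by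
  have hcard : ∀ t ≤ s.price o,
      (Finset.univ.filter fun x => t ≤ s.price x).card + t ≤ Fintype.card β := by
    intro t
    induction t with
    | zero => simp
    | succ t ih =>
      intro ht
      have := ih (by omega)
      have := hs.card_price_lt_card hb hg hA (t := t) (by omega)
      omega
  have hpos : 0 < (Finset.univ.filter fun x => s.price o ≤ s.price x).card :=
    Finset.card_pos.mpr ⟨o, by simp⟩
  have := hcard _ le_rfl
  omega

variable [DecidableEq β]

/-- Bidder `i` takes the object `o` from its holder, which raises its price. -/
def award (s : AuctionState α β) (i : α) (o : β) : AuctionState α β where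
  price := Function.update s.price o (s.price o + 1)
  holder := Function.update s.holder o (some i)

open Classical in
/-- Bidder `b.1` gets the opportunity to bid for the object `b.2`. -/
noncomputable def offer (A : α → β → Prop) (s : AuctionState α β) (b : α × β) :
    AuctionState α β :=
  if s.Bids A b.1 b.2 then s.award b.1 b.2 else s

/-- One round of the auction: the offers in `l` in turn. -/
noncomputable def sweep (A : α → β → Prop) (l : List (α × β)) (s : AuctionState α β) :
    AuctionState α β :=
  l.foldl (offer A) s

/-- The auction in which every round consists of the offers in `l`. -/
noncomputable def auction [Fintype β] (A : α → β → Prop) (l : List (α × β)) : AuctionState α β :=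
  (sweep A l)^[Fintype.card β * Fintype.card β] ⟨fun _ => 0, fun _ => none⟩

theorem Feasible.award (hs : s.Feasible A) (hb : s.Bids A i o) : (s.award i o).Feasible A := by
  obtain ⟨hfree, hacc, hcheap⟩ := hb
  constructor
  · intro x y j hx hy
    have := @hs.holder_injective x y j
    simp only [AuctionState.award, Function.update_apply] at hx hy
    grind
  · intro x j hx
    have := @hs.acceptable x j
    simp only [AuctionState.award, Function.update_apply] at hx
    grind
  · intro x j hx y hy
    have hle := @hs.price_le x j
    simp only [AuctionState.award, Function.update_apply] at hx ⊢
    grind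
  · intro x hx
    have := @hs.price_eq_zero x
    simp only [AuctionState.award, Function.update_apply] at hx ⊢
    grind

theorem sum_price_award [Fintype β] :
    ∑ x, (s.award i o).price x = ∑ x, s.price x + 1 := by
  have hrest : ∀ x ∈ Finset.univ.erase o, (s.award i o).price x = s.price x := fun x hx =>
    Function.update_of_ne (Finset.ne_of_mem_erase hx) _ _
  have ho : (s.award i o).price o = s.price o + 1 := Function.update_self _ _ _
  rw [← Finset.add_sum_erase _ _ (Finset.mem_univ o),
    ← Finset.add_sum_erase _ s.price (Finset.mem_univ o), Finset.sum_congr rfl hrest, ho]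
  ring

theorem sum_price_le_offer [Fintype β] (s : AuctionState α β) (b : α × β) :
    ∑ x, s.price x ≤ ∑ x, (s.offer A b).price x := by
  unfold offer
  split_ifs
  · exact (Nat.le_succ _).trans_eq sum_price_award.symm
  · exact le_rfl

theorem sum_price_le_sweep [Fintype β] (l : List (α × β)) (s : AuctionState α β) :
    ∑ x, s.price x ≤ ∑ x, (sweep A l s).price x := by
  induction l generalizing s with
  | nil => exact le_rfl
  | cons b l ih => exact (s.sum_price_le_offer b).trans (ih _)

theorem sum_price_lt_sweep [Fintype β] {l : List (α × β)} {b : α × β} (hl : b ∈ l)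
    (hb : s.Bids A b.1 b.2) : ∑ x, s.price x < ∑ x, (sweep A l s).price x := by
  induction l generalizing s with
  | nil => exact (List.not_mem_nil hl).elim
  | cons c l ih =>
    by_cases hc : s.Bids A c.1 c.2
    · calc ∑ x, s.price x < ∑ x, (s.award c.1 c.2).price x := by simp [sum_price_award]
        _ = ∑ x, (s.offer A c).price x := by rw [offer, if_pos hc]
        _ ≤ ∑ x, (sweep A (c :: l) s).price x := sum_price_le_sweep l _
    · have hbl : b ∈ l := (List.mem_cons.mp hl).resolve_left fun h => hc (h ▸ hb)
      rw [sweep, List.foldl_cons, offer, if_neg hc]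
      exact ih hbl hb

theorem sweep_eq_self {l : List (α × β)} (h : ∀ b ∈ l, ¬ s.Bids A b.1 b.2) :
    sweep A l s = s := by
  induction l with
  | nil => rfl
  | cons b l ih =>
    rw [List.forall_mem_cons] at h
    rw [sweep, List.foldl_cons, offer, if_neg h.1]
    exact ih h.2

theorem le_sum_price_iterate_sweep [Fintype β] {l : List (α × β)} {t : ℕ} {b : α × β}
    (hl : b ∈ l) (hb : ((sweep A l)^[t] s).Bids A b.1 b.2) :
    t ≤ ∑ x, ((sweep A l)^[t] s).price x := by
  induction t generalizing b with
  | zero => exact Nat.zero_le _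
  | succ t ih =>
    rw [Function.iterate_succ_apply'] at hb ⊢
    by_cases hbids : ∃ c ∈ l, ((sweep A l)^[t] s).Bids A c.1 c.2
    · obtain ⟨c, hc, hbc⟩ := hbids
      exact (ih hc hbc).trans_lt (sum_price_lt_sweep hc hbc)
    · simp only [not_exists, not_and] at hbids
      rw [sweep_eq_self hbids] at hb
      exact (hbids b hl hb).elim

theorem auction_induction [Fintype β] {C : AuctionState α β → Prop}
    (hinit : C ⟨fun _ => 0, fun _ => none⟩)
    (haward : ∀ s i o, C s → s.Bids A i o → C (s.award i o)) (l : List (α × β)) :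
    C (auction A l) := by
  refine Function.Iterate.rec C hinit (fun s hs => ?_) _
  refine List.foldlRecOn l _ hs fun s hs b _ => ?_
  unfold offer
  split_ifs with hb
  exacts [haward s b.1 b.2 hs hb, hs]

variable [Fintype β]

theorem price_auction_le {g : α → β} (hg : Function.Injective g) (hA : ∀ i, A i (g i))
    (l : List (α × β)) (x : β) : (auction A l).price x ≤ Fintype.card β := by
  refine (auction_induction (C := fun s => s.Feasible A ∧ ∀ x, s.price x ≤ Fintype.card β)
    ⟨.initial, fun _ => Nat.zero_le _⟩ (fun s i o hs hb => ⟨hs.1.award hb, fun y => ?_⟩) l).2 x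
  have hlt := hs.1.price_lt_card hb hg hA
  simp only [award, Function.update_apply]
  split_ifs
  exacts [hlt, hs.2 y]

theorem feasible_auction (l : List (α × β)) : (auction A l).Feasible A :=
  auction_induction .initial (fun _ _ _ hs hb => hs.award hb) l

theorem auction_not_bids {g : α → β} (hg : Function.Injective g) (hA : ∀ i, A i (g i))
    {l : List (α × β)} {b : α × β} (hl : b ∈ l) : ¬ (auction A l).Bids A b.1 b.2 := by
  intro hb
  have hlt := (feasible_auction l).price_lt_card hb hg hA
  have hsum : ∑ x, (auction A l).price x < ∑ _x : β, Fintype.card β :=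
    Finset.sum_lt_sum (fun x _ => price_auction_le hg hA l x) ⟨b.2, Finset.mem_univ _, hlt⟩
  have hle : Fintype.card β * Fintype.card β ≤ ∑ x, (auction A l).price x :=
    le_sum_price_iterate_sweep hl hb
  rw [Finset.sum_const, Finset.card_univ, smul_eq_mul] at hsum
  omega

theorem forall_exists_holder_auction_iff {l : List (α × β)} (hl : ∀ b, b ∈ l) :
    (∀ i, ∃ x, (auction A l).holder x = some i) ↔
      ∃ g : α → β, Function.Injective g ∧ ∀ i, A i (g i) := by
  constructor
  · intro h
    choose g hg using h
    refine ⟨g, fun i j hij => ?_, fun i => (feasible_auction l).acceptable (hg i)⟩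
    have hgi := hg i
    rw [hij, hg j] at hgi
    exact (Option.some_injective _ hgi).symm
  · rintro ⟨g, hg, hA⟩ i
    by_contra! hfree
    obtain ⟨o, ho, hcheap⟩ :=
      Set.exists_min_image {x | A i x} (auction A l).price (Set.toFinite _) ⟨g i, hA i⟩
    exact auction_not_bids hg hA (hl (i, o)) ⟨hfree, ho, hcheap⟩

end AuctionState

/-! ## Loop programs and their compilation -/

namespace RAMState

@[simp] theorem setReg_reg (s : RAMState) (x v r : ℕ) :
    (s.setReg x v).reg r = if r = x then v else s.reg r := by
  simp [setReg, Function.update_apply]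

@[simp] theorem setReg_mem (s : RAMState) (x v : ℕ) : (s.setReg x v).mem = s.mem := rfl

@[simp] theorem setMem_reg (s : RAMState) (a v : ℕ) : (s.setMem a v).reg = s.reg := rfl

@[simp] theorem setMem_mem (s : RAMState) (a v : ℕ) :
    (s.setMem a v).mem = Function.update s.mem a v := rfl

end RAMState

/-- A bound on the running time together with a postcondition: the program `c` started in `s` halts
after at most `T` steps in a state satisfying `Q`. -/
def Runs (c : RAMProgram) (s : RAMState) (T : ℕ) (Q : RAMState → Prop) : Prop :=
  ∃ s' t, Exec c s s' t ∧ t ≤ T ∧ Q s'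

section Runs

variable {s s₁ : RAMState} {Q Q' : RAMState → Prop} {t T T' : ℕ} {c d : RAMProgram}

theorem Exec.runs (h : Exec c s s₁ t) (hQ : Q s₁) : Runs c s t Q :=
  ⟨s₁, t, h, le_rfl, hQ⟩

theorem Runs.mono (h : Runs c s T Q) (hT : T ≤ T') (hQ : ∀ s', Q s' → Q' s') :
    Runs c s T' Q' :=
  have ⟨s', t, hexec, ht, hs'⟩ := h
  ⟨s', t, hexec, ht.trans hT, hQ s' hs'⟩

theorem Runs.seq (h : Runs c s T Q) (h' : ∀ s', Q s' → Runs d s' T' Q') :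
    Runs (.seq c d) s (T + T') Q' :=
  have ⟨s₁, _, hexec₁, ht₁, hs₁⟩ := h
  have ⟨s₂, _, hexec₂, ht₂, hs₂⟩ := h' s₁ hs₁
  ⟨s₂, _, .seq hexec₁ hexec₂, add_le_add ht₁ ht₂, hs₂⟩

theorem Exec.seq_runs (h : Exec c s s₁ t) (h' : Runs d s₁ T Q) : Runs (.seq c d) s (t + T) Q :=
  (h.runs (Q := (· = s₁)) rfl).seq fun _ hs => hs ▸ h'

theorem Runs.cond {x : ℕ} (h : s.reg x ≠ 0 → Runs c s T Q) (h' : s.reg x = 0 → Runs d s T Q) :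
    Runs (.cond x c d) s (T + 1) Q := by
  by_cases hx : s.reg x = 0
  · obtain ⟨s', t, hexec, ht, hs'⟩ := h' hx
    exact ⟨s', _, .cond_zero hx hexec, Nat.succ_le_succ ht, hs'⟩
  · obtain ⟨s', t, hexec, ht, hs'⟩ := h hx
    exact ⟨s', _, .cond_nonzero hx hexec, Nat.succ_le_succ ht, hs'⟩

theorem Runs.loop {x : ℕ} (I : ℕ → RAMState → Prop) (hreg : ∀ j s, I j s → s.reg x = j)
    (hbody : ∀ j s, I (j + 1) s → Runs c s T (I j)) {j : ℕ} (hs : I j s) :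
    Runs (.loop x c) s (j * (T + 1) + 1) (I 0) := by
  induction j generalizing s with
  | zero => exact ⟨s, 1, .loop_zero (hreg _ _ hs), by omega, hs⟩
  | succ j ih =>
    obtain ⟨s₁, t₁, hexec₁, ht₁, hs₁⟩ := hbody j s hs
    obtain ⟨s₂, t₂, hexec₂, ht₂, hs₂⟩ := ih hs₁
    refine ⟨s₂, _, .loop_nonzero (by rw [hreg _ _ hs]; omega) hexec₁ hexec₂, ?_, hs₂⟩
    rw [add_mul]
    omega

end Runs

/-- The register holding the size of the input of a compiled loop program. -/
def sizeReg : ℕ := 1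

/-- The register holding the variable `x` in a compiled loop program. Variables are held in the
positive even registers. -/
def varReg {V : Type*} [Encodable V] (x : V) : ℕ := 2 * Encodable.encode x + 2

/-- The `d`-th scratch register of a compiled loop program. -/
def scratch (d : ℕ) : ℕ := 2 * d + 3

theorem varReg_injective {V : Type*} [Encodable V] : Function.Injective (varReg (V := V)) :=
  fun x y h => Encodable.encode_injective (by unfold varReg at h; omega)

@[simp] theorem scratch_inj {d e : ℕ} : scratch d = scratch e ↔ d = e := by
  unfold scratch
  omega

@[simp] theorem varReg_ne_scratch {V : Type*} [Encodable V] (x : V) (d : ℕ) :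
    varReg x ≠ scratch d := by
  unfold varReg scratch
  omega

namespace RAMState

/-- The size of the input in a state of a compiled loop program. -/
def size (s : RAMState) : ℕ := s.reg sizeReg

/-- The values of the variables in a state of a compiled loop program. -/
def env (V : Type*) [Encodable V] (s : RAMState) : V → ℕ := fun x => s.reg (varReg x)

/-- The states `s` and `s'` agree on the size, the variables and the first `d` scratch registers. -/
def AgreeBelow (d : ℕ) (s s' : RAMState) : Prop :=
  ∀ r, r % 2 = 0 ∨ r < scratch d → s'.reg r = s.reg r

namespace AgreeBelow

variable {d e : ℕ} {s s' s'' : RAMState}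

theorem size_eq (h : AgreeBelow d s s') : s'.size = s.size :=
  h sizeReg (.inr (by unfold sizeReg scratch; omega))

theorem env_eq (V : Type*) [Encodable V] (h : AgreeBelow d s s') : s'.env V = s.env V :=
  funext fun x => h (varReg x) (.inl (by unfold varReg; omega))

theorem scratch_eq (h : AgreeBelow d s s') (he : e < d) :
    s'.reg (scratch e) = s.reg (scratch e) :=
  h (scratch e) (.inr (by unfold scratch; omega))

theorem trans (h : AgreeBelow d s s') (h' : AgreeBelow e s' s'') (he : d ≤ e) :
    AgreeBelow d s s'' := fun r hr =>
  (h' r (hr.imp_right fun hlt => by unfold scratch at *; omega)).trans (h r hr)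

theorem setReg (h : AgreeBelow d s s') (he : d ≤ e) (v : ℕ) :
    AgreeBelow d s (s'.setReg (scratch e) v) := fun r hr => by
  rw [setReg_reg, if_neg (by unfold scratch at *; omega), h r hr]

end AgreeBelow

theorem agreeBelow_refl (d : ℕ) (s : RAMState) : AgreeBelow d s s := fun _ _ => rfl

end RAMState

section ForEach

variable {V : Type*} [Encodable V]

/-- The program that runs `body` with the variable `x` ranging over the numbers below the size.
It clears the scratch register `d`, in which `body` may accumulate a result. -/
def forEach (x : V) (d : ℕ) (body : RAMProgram) : RAMProgram :=
  .seq (.const (scratch d) 0) <| .seq (.copy (scratch (d + 1)) sizeReg) <|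
  .seq (.copy (scratch (d + 2)) (varReg x)) <| .seq (.const (varReg x) 0) <|
  .seq (.loop (scratch (d + 1)) <| .seq body <| .seq (.const (scratch (d + 3)) 1) <|
    .seq (.add (varReg x) (varReg x) (scratch (d + 3)))
      (.sub (scratch (d + 1)) (scratch (d + 1)) (scratch (d + 3)))) <|
  .copy (varReg x) (scratch (d + 2))

/-- The invariant of the loop in `forEach x d body`, started in `s₀`, if `j` rounds remain. The
invariant `J` of `body` refers to the value of `x`, the accumulator and the memory. -/
structure ForEachInv (x : V) (d : ℕ) (s₀ : RAMState) (J : ℕ → ℕ → (ℕ → ℕ) → Prop) (j : ℕ)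
    (s : RAMState) : Prop where
  counter : s.reg (scratch (d + 1)) = j
  saved : s.reg (scratch (d + 2)) = s₀.reg (varReg x)
  le_size : j ≤ s₀.size
  var : s.reg (varReg x) = s₀.size - j
  agree : ∀ r, r % 2 = 0 ∨ r < scratch d → r ≠ varReg x → s.reg r = s₀.reg r
  inv : J (s₀.size - j) (s.reg (scratch d)) s.mem

variable {x : V} {d T : ℕ} {s : RAMState} {body : RAMProgram} {J : ℕ → ℕ → (ℕ → ℕ) → Prop}

theorem ForEachInv.size_eq {j : ℕ} {s' : RAMState} (h : ForEachInv x d s J j s') :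
    s'.size = s.size :=
  h.agree sizeReg (.inr (by unfold sizeReg scratch; omega)) (by unfold sizeReg varReg; omega)

theorem ForEachInv.env_eq [DecidableEq V] {j : ℕ} {s' : RAMState} (h : ForEachInv x d s J j s') :
    s'.env V = Function.update (s.env V) x (s.size - j) := by
  funext y
  rcases eq_or_ne y x with rfl | hy
  · rw [Function.update_self, ← h.var]
    rfl
  · rw [Function.update_of_ne hy]
    exact h.agree _ (.inl (by unfold varReg; omega)) (varReg_injective.ne hy)

theorem ForEachInv.runs_step [DecidableEq V] {j : ℕ} {s' : RAMState}
    (h : ForEachInv x d s J (j + 1) s')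
    (hbody : ∀ v < s.size, ∀ s', s'.size = s.size → s'.env V = Function.update (s.env V) x v →
      J v (s'.reg (scratch d)) s'.mem → Runs body s' T fun s'' =>
        J (v + 1) (s''.reg (scratch d)) s''.mem ∧
        ∀ r, r % 2 = 0 ∨ r < scratch (d + 3) → r ≠ scratch d → s''.reg r = s'.reg r) :
    Runs (.seq body <| .seq (.const (scratch (d + 3)) 1) <|
      .seq (.add (varReg x) (varReg x) (scratch (d + 3)))
        (.sub (scratch (d + 1)) (scratch (d + 1)) (scratch (d + 3)))) s' (T + 3)
      (ForEachInv x d s J j) := by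
  have hj := h.le_size
  refine (hbody _ (by omega) s' h.size_eq h.env_eq h.inv).seq fun s₁ ⟨hJ, hagree⟩ =>
    (Exec.const _ _ _).seq_runs <| (Exec.add _ _ _ _).seq_runs <| (Exec.sub _ _ _ _).runs ?_
  have hcounter := hagree (scratch (d + 1)) (.inr (by unfold scratch; omega)) (by simp)
  have hsaved := hagree (scratch (d + 2)) (.inr (by unfold scratch; omega)) (by simp)
  have hvar := hagree (varReg x) (.inl (by unfold varReg; omega)) (varReg_ne_scratch x d)
  have hkept := fun r hr (hrx : r ≠ varReg x) =>
    (hagree r (hr.imp_right fun hlt => by unfold scratch at *; omega)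
      (by unfold scratch at *; omega)).trans (h.agree r hr hrx)
  rw [h.counter] at hcounter
  rw [h.saved] at hsaved
  rw [h.var] at hvar
  rw [show s.size - (j + 1) + 1 = s.size - j by omega] at hJ
  refine ⟨?_, ?_, by omega, ?_, fun r hr hrx => ?_, ?_⟩
  · simp [hcounter, (varReg_ne_scratch x _).symm]
  · simp [hsaved, (varReg_ne_scratch x _).symm]
  · simp only [RAMState.setReg_reg, if_true, varReg_ne_scratch, if_false, hvar]
    omega
  · have hne : ∀ e, d ≤ e → r ≠ scratch e := fun e he => by unfold scratch at *; omega
    simp [hrx, hne, hkept r hr hrx]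
  · simpa [(varReg_ne_scratch x _).symm] using hJ

theorem runs_forEach [DecidableEq V] (h₀ : J 0 0 s.mem)
    (hbody : ∀ v < s.size, ∀ s', s'.size = s.size → s'.env V = Function.update (s.env V) x v →
      J v (s'.reg (scratch d)) s'.mem → Runs body s' T fun s'' =>
        J (v + 1) (s''.reg (scratch d)) s''.mem ∧
        ∀ r, r % 2 = 0 ∨ r < scratch (d + 3) → r ≠ scratch d → s''.reg r = s'.reg r) :
    Runs (forEach x d body) s (s.size * (T + 4) + 6) fun s' =>
      J s.size (s'.reg (scratch d)) s'.mem ∧ s.AgreeBelow d s' := by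
  have hT : 1 + (1 + (1 + (1 + (s.size * (T + 3 + 1) + 1 + 1)))) ≤ s.size * (T + 4) + 6 := by
    rw [add_assoc T]
    omega
  refine Runs.mono ?_ hT fun _ h => h
  refine (Exec.const _ _ _).seq_runs <| (Exec.copy _ _ _).seq_runs <|
    (Exec.copy _ _ _).seq_runs <| (Exec.const _ _ _).seq_runs ?_
  refine (Runs.loop (ForEachInv x d s J) (fun _ _ h => h.counter)
    (fun j s' h => h.runs_step hbody) ?_).seq fun s' h => (Exec.copy _ _ _).runs ?_
  · have hsize : sizeReg ≠ scratch d := by unfold sizeReg scratch; omega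
    refine ⟨?_, ?_, le_rfl, ?_, fun r hr hrx => ?_, ?_⟩
    · simp [(varReg_ne_scratch x _).symm, hsize, RAMState.size]
    · simp [(varReg_ne_scratch x _).symm]
    · simp
    · have hne : ∀ e, d ≤ e → r ≠ scratch e := fun e he => by unfold scratch at *; omega
      simp [hrx, hne]
    · simpa [(varReg_ne_scratch x _).symm] using h₀
  · refine ⟨by simpa [(varReg_ne_scratch x _).symm] using h.inv, fun r hr => ?_⟩
    rw [RAMState.setReg_reg]
    split_ifs with hrx
    · rw [h.saved, hrx]
    · exact h.agree r hr hrx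

end ForEach

/-- Arithmetic expressions over the memory in variables from `V`. -/
inductive LoopExpr (V : Type*)
  | var (x : V)
  /-- the size of the input -/
  | size
  | const (c : ℕ)
  | add (a b : LoopExpr V)
  /-- truncated subtraction -/
  | sub (a b : LoopExpr V)
  /-- the memory cell with address `a` -/
  | load (a : LoopExpr V)
  /-- the sum of the values of `e`, with the variable `x` ranging over the numbers below the size -/
  | sum (x : V) (e : LoopExpr V)

namespace LoopExpr

variable {V : Type*} [DecidableEq V] [Encodable V]

/-- The value of an expression if the size of the input is `N`. -/
def eval (N : ℕ) (mem : ℕ → ℕ) : LoopExpr V → (V → ℕ) → ℕ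
  | var x, env => env x
  | size, _ => N
  | const c, _ => c
  | add a b, env => a.eval N mem env + b.eval N mem env
  | sub a b, env => a.eval N mem env - b.eval N mem env
  | load a, env => mem (a.eval N mem env)
  | sum x e, env => ∑ v ∈ Finset.range N, e.eval N mem (Function.update env x v)

/-- A program that computes an expression in the scratch register `d`, leaving the lower scratch
registers alone. -/
def compile : LoopExpr V → ℕ → RAMProgram
  | var x, d => .copy (scratch d) (varReg x)
  | size, d => .copy (scratch d) sizeReg
  | const c, d => .const (scratch d) c
  | add a b, d => .seq (a.compile d) <| .seq (b.compile (d + 1)) <|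
      .add (scratch d) (scratch d) (scratch (d + 1))
  | sub a b, d => .seq (a.compile d) <| .seq (b.compile (d + 1)) <|
      .sub (scratch d) (scratch d) (scratch (d + 1))
  | load a, d => .seq (a.compile d) (.load (scratch d) (scratch d))
  | sum x e, d => forEach x d <| .seq (e.compile (d + 3)) <|
      .add (scratch d) (scratch d) (scratch (d + 3))

/-- A bound on the number of steps that the program of an expression takes, as a polynomial in the
size of the input. -/
noncomputable def cost : LoopExpr V → Polynomial ℕ
  | var _ | size | const _ => 1
  | add a b | sub a b => a.cost + (b.cost + 1)
  | load a => a.cost + 1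
  | sum _ e => Polynomial.X * (e.cost + 1 + 4) + 6

/-- The program of `e` computes the value of `e` in the scratch register `d`. -/
def Computes (e : LoopExpr V) : Prop :=
  ∀ (d : ℕ) (s : RAMState), Runs (e.compile d) s (e.cost.eval s.size) fun s' =>
    s'.reg (scratch d) = e.eval s.size s.mem (s.env V) ∧ s'.mem = s.mem ∧ s.AgreeBelow d s'

theorem Computes.runs_pair {a b : LoopExpr V} (ha : a.Computes) (hb : b.Computes) {d T : ℕ}
    {s : RAMState} {c : RAMProgram} {Q : RAMState → Prop}
    (hc : ∀ s', s'.reg (scratch d) = a.eval s.size s.mem (s.env V) →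
      s'.reg (scratch (d + 1)) = b.eval s.size s.mem (s.env V) → s'.mem = s.mem →
      s.AgreeBelow d s' → Runs c s' T Q) :
    Runs (.seq (a.compile d) <| .seq (b.compile (d + 1)) c) s
      (a.cost.eval s.size + (b.cost.eval s.size + T)) Q := by
  refine (ha d s).seq fun s₁ ⟨hval, hmem, hagree⟩ => ?_
  have hb' := hb (d + 1) s₁
  rw [hagree.size_eq, hagree.env_eq V, hmem] at hb'
  refine hb'.seq fun s₂ ⟨hval', hmem', hagree'⟩ => hc s₂ ?_ hval' hmem' ?_
  · rw [hagree'.scratch_eq d.lt_succ_self, hval]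
  · exact hagree.trans hagree' d.le_succ

theorem Computes.sum {e : LoopExpr V} (he : e.Computes) (x : V) : (sum x e).Computes := by
  intro d s
  simp only [cost, Polynomial.eval_add, Polynomial.eval_mul, Polynomial.eval_X,
    Polynomial.eval_one, Polynomial.eval_ofNat]
  refine (runs_forEach (J := fun v acc mem => acc =
    ∑ w ∈ Finset.range v, e.eval s.size s.mem (Function.update (s.env V) x w) ∧ mem = s.mem)
    ⟨rfl, rfl⟩ fun v _ s₁ hsize henv ⟨hacc, hmem⟩ => ?_).mono le_rfl fun s' ⟨h, hagree⟩ =>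
      ⟨h.1, h.2, hagree⟩
  have he' := he (d + 3) s₁
  rw [hsize, henv, hmem] at he'
  refine he'.seq fun s₂ ⟨hval, hmem', hagree⟩ => (Exec.add _ _ _ _).runs
    ⟨⟨?_, hmem'⟩, fun r hr hrd => ?_⟩
  · rw [RAMState.setReg_reg, if_pos rfl, hagree.scratch_eq (by omega), hacc, hval,
      Finset.sum_range_succ]
  · rw [RAMState.setReg_reg, if_neg hrd, hagree r hr]

theorem computes (e : LoopExpr V) : e.Computes := by
  induction e with
  | var | size =>
    intro d s
    simp only [cost, Polynomial.eval_one]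
    exact (Exec.copy _ _ _).runs ⟨by simp [eval, RAMState.env, RAMState.size], rfl,
      (s.agreeBelow_refl d).setReg le_rfl _⟩
  | const c =>
    intro d s
    simp only [cost, Polynomial.eval_one]
    exact (Exec.const _ _ _).runs ⟨by simp [eval], rfl, (s.agreeBelow_refl d).setReg le_rfl _⟩
  | add a b iha ihb =>
    intro d s
    simp only [cost, Polynomial.eval_add, Polynomial.eval_one]
    exact iha.runs_pair ihb fun s' ha hb hmem hagree => (Exec.add _ _ _ _).runs
      ⟨by simp [eval, ha, hb], hmem, hagree.setReg le_rfl _⟩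
  | sub a b iha ihb =>
    intro d s
    simp only [cost, Polynomial.eval_add, Polynomial.eval_one]
    exact iha.runs_pair ihb fun s' ha hb hmem hagree => (Exec.sub _ _ _ _).runs
      ⟨by simp [eval, ha, hb], hmem, hagree.setReg le_rfl _⟩
  | load a ih =>
    intro d s
    simp only [cost, Polynomial.eval_add, Polynomial.eval_one]
    exact (ih d s).seq fun s' ⟨hval, hmem, hagree⟩ => (Exec.load _ _ _).runs
      ⟨by simp [eval, hval, hmem], hmem, hagree.setReg le_rfl _⟩
  | sum x e ih => exact ih.sum x

end LoopExpr

/-- Statements that write to the memory, with loops over the numbers below the size of the input.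
The loop variables cannot be assigned. -/
inductive LoopStmt (V : Type*)
  /-- store the value of `e` in the memory cell with address `a` -/
  | store (a e : LoopExpr V)
  | seq (b c : LoopStmt V)
  /-- run `b` if the value of `e` is `0` -/
  | guard (e : LoopExpr V) (b : LoopStmt V)
  /-- run `b` with the variable `x` ranging over the numbers below the size -/
  | forRange (x : V) (b : LoopStmt V)

namespace LoopStmt

variable {V : Type*} [DecidableEq V] [Encodable V]

/-- The effect of a statement on the memory if the size of the input is `N`. -/
def exec (N : ℕ) : LoopStmt V → (V → ℕ) → (ℕ → ℕ) → ℕ → ℕ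
  | store a e, env, mem => Function.update mem (a.eval N mem env) (e.eval N mem env)
  | seq b c, env, mem => c.exec N env (b.exec N env mem)
  | guard e b, env, mem => if e.eval N mem env = 0 then b.exec N env mem else mem
  | forRange x b, env, mem =>
      (List.range N).foldl (fun mem v => b.exec N (Function.update env x v) mem) mem

/-- The program of a statement, leaving the scratch registers below `d` alone. -/
def compile : LoopStmt V → ℕ → RAMProgram
  | store a e, d => .seq (a.compile d) <| .seq (e.compile (d + 1)) <|
      .store (scratch d) (scratch (d + 1))
  | seq b c, d => .seq (b.compile d) (c.compile d)
  | guard e b, d => .seq (e.compile d) <| .cond (scratch d) .skip (b.compile d)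
  | forRange x b, d => forEach x d (b.compile (d + 3))

/-- A bound on the number of steps that the program of a statement takes, as a polynomial in the
size of the input. -/
noncomputable def cost : LoopStmt V → Polynomial ℕ
  | store a e => a.cost + (e.cost + 1)
  | seq b c => b.cost + c.cost
  | guard e b => e.cost + (b.cost + 1 + 1)
  | forRange _ b => Polynomial.X * (b.cost + 4) + 6

/-- The program of `b` has the effect of `b` on the memory. -/
def Computes (b : LoopStmt V) : Prop :=
  ∀ (d : ℕ) (s : RAMState), Runs (b.compile d) s (b.cost.eval s.size) fun s' =>
    s'.mem = b.exec s.size (s.env V) s.mem ∧ s.AgreeBelow d s'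

theorem Computes.seq {b c : LoopStmt V} (hb : b.Computes) (hc : c.Computes) :
    (seq b c).Computes := by
  intro d s
  simp only [cost, Polynomial.eval_add]
  refine (hb d s).seq fun s₁ ⟨hmem, hagree⟩ => ?_
  have hc' := hc d s₁
  rw [hagree.size_eq, hagree.env_eq V, hmem] at hc'
  exact hc'.mono le_rfl fun s₂ ⟨hmem', hagree'⟩ => ⟨hmem', hagree.trans hagree' le_rfl⟩

theorem Computes.guard {b : LoopStmt V} (hb : b.Computes) (e : LoopExpr V) :
    (guard e b).Computes := by
  intro d s
  simp only [cost, Polynomial.eval_add, Polynomial.eval_one]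
  refine (e.computes d s).seq fun s₁ ⟨hval, hmem, hagree⟩ => .cond (fun he => ?_) fun he => ?_
  · exact ((Exec.skip s₁).runs ⟨by rw [exec, if_neg (hval ▸ he), hmem], hagree⟩).mono
      (by omega) fun _ h => h
  · have hb' := hb d s₁
    rw [hagree.size_eq, hagree.env_eq V, hmem] at hb'
    exact hb'.mono (by omega) fun s₂ ⟨hmem', hagree'⟩ =>
      ⟨by rw [exec, if_pos (hval ▸ he), hmem'], hagree.trans hagree' le_rfl⟩

theorem Computes.forRange {b : LoopStmt V} (hb : b.Computes) (x : V) :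
    (forRange x b).Computes := by
  intro d s
  simp only [cost, Polynomial.eval_add, Polynomial.eval_mul, Polynomial.eval_X,
    Polynomial.eval_ofNat]
  refine runs_forEach (J := fun v _ mem => mem = (List.range v).foldl
    (fun mem w => b.exec s.size (Function.update (s.env V) x w) mem) s.mem)
    rfl fun v _ s₁ hsize henv hmem => ?_
  have hb' := hb (d + 3) s₁
  rw [hsize, henv, hmem] at hb'
  exact hb'.mono le_rfl fun s₂ ⟨hmem', hagree⟩ =>
    ⟨by rw [hmem', List.range_succ, List.foldl_concat], fun r hr _ => hagree r hr⟩

theorem computes (b : LoopStmt V) : b.Computes := by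
  induction b with
  | store a e =>
    intro d s
    simp only [cost, Polynomial.eval_add, Polynomial.eval_one]
    exact a.computes.runs_pair e.computes fun s' ha he hmem hagree => (Exec.store _ _ _).runs
      ⟨by simp [exec, ha, he, hmem], hagree⟩
  | seq b c hb hc => exact hb.seq hc
  | guard e b hb => exact hb.guard e
  | forRange x b hb => exact hb.forRange x

end LoopStmt

theorem polynomial_nat_eval_mono (q : Polynomial ℕ) : Monotone fun x => q.eval x := by
  intro a b h
  simp only [Polynomial.eval_eq_sum]
  exact Finset.sum_le_sum fun i _ => Nat.mul_le_mul_left _ (Nat.pow_le_pow_left h i)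

theorem decidableInPolyTime_of_loopStmt {V : Type*} [DecidableEq V] [Encodable V] {α : Type}
    {enc : α → List ℕ} {P : α → Prop} [DecidablePred P] (b : LoopStmt V) (e : LoopExpr V)
    (hsize : ∀ a, (enc a).getD 0 0 ≤ inputSize (enc a))
    (hP : ∀ a, e.eval ((enc a).getD 0 0)
      (b.exec ((enc a).getD 0 0) 0 fun x => (enc a).getD x 0) 0 = if P a then 1 else 0) :
    DecidableInPolyTime enc P := by
  refine ⟨.seq (.load sizeReg (scratch 0)) <| .seq (b.compile 0) <| .seq (e.compile 0) <|
    .copy 0 (scratch 0), 1 + (b.cost + (e.cost + 1)), fun a => ?_⟩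
  set N := (enc a).getD 0 0 with hN
  have hrun : Runs (.seq (.load sizeReg (scratch 0)) <| .seq (b.compile 0) <|
      .seq (e.compile 0) <| .copy 0 (scratch 0)) (RAMState.init (enc a))
      (1 + (b.cost.eval N + (e.cost.eval N + 1))) fun s => s.reg 0 = if P a then 1 else 0 := by
    refine (Exec.load _ _ _).seq_runs ?_
    set s₀ := (RAMState.init (enc a)).setReg sizeReg _ with hs₀
    have hs₀N : s₀.size = N := by simp [hs₀, RAMState.size, RAMState.init, scratch, hN]
    have hs₀env : s₀.env V = 0 := by
      funext x
      simp [hs₀, RAMState.env, RAMState.init, varReg, sizeReg]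
    rw [← hs₀N]
    refine (b.computes 0 s₀).seq fun s₁ ⟨hmem, hagree⟩ => ?_
    have he := e.computes 0 s₁
    rw [hagree.size_eq, hagree.env_eq V] at he
    refine he.seq fun s₂ ⟨hval, _, _⟩ => (Exec.copy _ _ _).runs ?_
    rw [RAMState.setReg_reg, if_pos rfl, hval, hmem, hs₀N, hs₀env, ← hP a]
    rfl
  obtain ⟨s, t, hexec, ht, hs⟩ := hrun
  refine ⟨s, t, hexec, ht.trans ?_, fun h => hs.trans (if_pos h), fun h => hs.trans (if_neg h)⟩
  simp only [Polynomial.eval_add, Polynomial.eval_one]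
  gcongr
  exacts [polynomial_nat_eval_mono _ (hsize a), polynomial_nat_eval_mono _ (hsize a)]

/-! ## The input in the memory -/

/-- The address of the object in position `r` of the list of agent `i`, for `n` agents. -/
def prefAddr (n i r : ℕ) : ℕ := 1 + (n * i + r)

/-- The address of the numerator of the entry `(i, o)` of the random assignment. -/
def entryAddr (n i o : ℕ) : ℕ := 1 + n * n + ((n * i + o) + (n * i + o))

/-- The address of the result, which is the first address behind the input. -/
def resultAddr (n : ℕ) : ℕ := 1 + (n * n + n * n + n * n)

theorem mul_add_lt_mul_self {n i r : ℕ} (hi : i < n) (hr : r < n) : n * i + r < n * n := by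
  have hle : n * (i + 1) ≤ n * n := Nat.mul_le_mul_left n hi
  rw [mul_add] at hle
  omega

theorem prefAddr_lt_resultAddr {n i r : ℕ} (hi : i < n) (hr : r < n) :
    prefAddr n i r < resultAddr n := by
  have := mul_add_lt_mul_self hi hr
  unfold prefAddr resultAddr
  omega

theorem entryAddr_lt_resultAddr {n i o : ℕ} (hi : i < n) (ho : o < n) :
    entryAddr n i o < resultAddr n := by
  have := mul_add_lt_mul_self hi ho
  unfold entryAddr resultAddr
  omega

theorem getD_flatMap_of_forall_length_eq {α β : Type*} {f : α → List β} {m : ℕ} {l : List α}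
    (hf : ∀ x ∈ l, (f x).length = m) {i r : ℕ} (hi : i < l.length) (hr : r < m) (b : β) :
    (l.flatMap f).getD (m * i + r) b = (f l[i]).getD r b := by
  induction l generalizing i with
  | nil => simp at hi
  | cons x l ih =>
    rw [List.forall_mem_cons] at hf
    rw [List.flatMap_cons]
    cases i with
    | zero => rw [List.getD_append _ _ _ _ (by simpa [hf.1] using hr)]; simp
    | succ i =>
      rw [List.getD_append_right _ _ _ _ (by rw [hf.1, mul_add]; omega), hf.1,
        show m * (i + 1) + r - m = m * i + r by rw [mul_add]; omega,
        ih hf.2 (by simpa using hi), List.getElem_cons_succ]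

theorem length_le_inputSize (l : List ℕ) : l.length ≤ inputSize l := by
  rw [inputSize, ← List.length_map (fun x : ℕ => x.size + 1)]
  refine List.length_le_sum_of_one_le _ fun x hx => ?_
  obtain ⟨y, -, rfl⟩ := List.mem_map.mp hx
  exact Nat.le_add_left 1 _

namespace AssignmentInstance

variable (I : AssignmentInstance)

theorem encode_getD_prefAddr (i r : Fin I.n) :
    I.encode.getD (prefAddr I.n i r) 0 = I.pref i r := by
  have hlt := mul_add_lt_mul_self i.2 r.2
  rw [encode, prefAddr, add_comm 1, List.cons_append, List.getD_cons_succ,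
    List.getD_append _ _ _ _ (by simpa [List.length_flatMap] using hlt),
    getD_flatMap_of_forall_length_eq (m := I.n) (by simp) (by simp) r.2]
  simp

theorem encode_getD_entryAddr (i o : Fin I.n) :
    I.encode.getD (entryAddr I.n i o) 0 = (I.p i o).num.natAbs := by
  rw [encode, entryAddr, add_comm 1, add_right_comm, List.cons_append, List.getD_cons_succ,
    List.getD_append_right _ _ _ _ (by simp [List.length_flatMap])]
  simp only [List.length_flatMap, List.length_map, List.length_finRange, List.map_const',
    List.sum_replicate, smul_eq_mul, Nat.add_sub_cancel_left]
  rw [show I.n * i + o + (I.n * i + o) = (2 * I.n) * i + (2 * o + 0) by ring,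
    getD_flatMap_of_forall_length_eq (by simp [List.length_flatMap, mul_comm]) (by simp)
      (by omega),
    getD_flatMap_of_forall_length_eq (by simp) (by simp) (by omega)]
  simp

theorem size_le_inputSize : I.n ≤ inputSize I.encode := by
  refine le_trans ?_ (length_le_inputSize _)
  simp only [encode, List.length_append, List.length_cons, List.length_flatMap, List.length_map,
    List.length_finRange, List.map_const', List.sum_replicate, smul_eq_mul]
  have := Nat.le_mul_self I.n
  omega

theorem natAbs_num_pos_iff {i o : Fin I.n} : 0 < (I.p i o).num.natAbs ↔ 0 < I.realMatrix i o := by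
  rw [realMatrix, Matrix.map_apply, Rat.cast_pos, Int.natAbs_pos, Ne, Rat.num_eq_zero]
  exact (nonneg_of_mem_doublyStochastic I.p_mem).lt_iff_ne'.symm

theorem realMatrix_mem : I.realMatrix ∈ doublyStochastic ℝ (Fin I.n) := by
  obtain ⟨hnonneg, hrow, hcol⟩ := mem_doublyStochastic_iff_sum.mp I.p_mem
  simp only [mem_doublyStochastic_iff_sum, realMatrix, Matrix.map_apply]
  exact ⟨fun i o => by exact_mod_cast hnonneg i o, fun i => by exact_mod_cast hrow i,
    fun o => by exact_mod_cast hcol o⟩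

/-- The memory `mem` holds the encoding of the instance, followed by the result `r`. -/
structure Stored (r : ℕ) (mem : ℕ → ℕ) : Prop where
  input : ∀ a < resultAddr I.n, mem a = I.encode.getD a 0
  result : mem (resultAddr I.n) = r

variable {I} {r : ℕ} {mem : ℕ → ℕ}

theorem Stored.prefAddr_eq (h : I.Stored r mem) (i t : Fin I.n) :
    mem (prefAddr I.n i t) = I.pref i t := by
  rw [h.input _ (prefAddr_lt_resultAddr i.2 t.2), encode_getD_prefAddr]

theorem Stored.entryAddr_pos_iff (h : I.Stored r mem) {i o : Fin I.n} :
    0 < mem (entryAddr I.n i o) ↔ 0 < I.realMatrix i o := by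
  rw [h.input _ (entryAddr_lt_resultAddr i.2 o.2), encode_getD_entryAddr, natAbs_num_pos_iff]

theorem Stored.update (h : I.Stored r mem) {a : ℕ} (ha : resultAddr I.n < a) (v : ℕ) :
    I.Stored r (Function.update mem a v) :=
  ⟨fun b hb => by rw [Function.update_of_ne (by omega), h.input b hb],
    by rw [Function.update_of_ne ha.ne, h.result]⟩

theorem Stored.update_result (h : I.Stored r mem) (v : ℕ) :
    I.Stored v (Function.update mem (resultAddr I.n) v) :=
  ⟨fun a ha => by rw [Function.update_of_ne ha.ne, h.input a ha], Function.update_self _ _ _⟩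

end AssignmentInstance

/-! ## The program -/

namespace LoopExpr

variable {V : Type*}

/-- The formula `a ≤ b`. An expression is read as a formula that holds if its value is `0`, so that
`add` is conjunction and `sum` is universal quantification over the numbers below the size. -/
def le (a b : LoopExpr V) : LoopExpr V := sub a b

/-- The formula `a < b`. -/
def lt (a b : LoopExpr V) : LoopExpr V := le (add a (const 1)) b

/-- The formula `a = b`. -/
def eq (a b : LoopExpr V) : LoopExpr V := add (le a b) (le b a)

/-- Negation. -/
def neg (a : LoopExpr V) : LoopExpr V := sub (const 1) a

/-- Implication. -/
def imp (a b : LoopExpr V) : LoopExpr V := neg (add a (neg b))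

/-- Equivalence. -/
def iff (a b : LoopExpr V) : LoopExpr V := add (imp a b) (imp b a)

/-- Existential quantification over the numbers below the size. -/
def ex (x : V) (a : LoopExpr V) : LoopExpr V := neg (sum x (neg a))

/-- The conjunction of finitely many formulas. -/
def conj {m : ℕ} (f : Fin m → LoopExpr V) : LoopExpr V := (List.ofFn f).foldr add (const 0)

variable [DecidableEq V]

/-- The expression `e`, as a formula, holds. -/
def Holds (N : ℕ) (mem : ℕ → ℕ) (e : LoopExpr V) (env : V → ℕ) : Prop := e.eval N mem env = 0

variable {N : ℕ} {mem : ℕ → ℕ} {env : V → ℕ} {a b : LoopExpr V} {x : V}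

theorem holds_le : (le a b).Holds N mem env ↔ a.eval N mem env ≤ b.eval N mem env :=
  Nat.sub_eq_zero_iff_le

theorem holds_lt : (lt a b).Holds N mem env ↔ a.eval N mem env < b.eval N mem env :=
  holds_le

theorem holds_add : (add a b).Holds N mem env ↔ a.Holds N mem env ∧ b.Holds N mem env :=
  Nat.add_eq_zero_iff

theorem holds_eq : (eq a b).Holds N mem env ↔ a.eval N mem env = b.eval N mem env := by
  rw [eq, holds_add, holds_le, holds_le, le_antisymm_iff]

theorem holds_neg : (neg a).Holds N mem env ↔ ¬ a.Holds N mem env := by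
  simp only [Holds, neg, eval]
  omega

theorem holds_imp : (imp a b).Holds N mem env ↔ (a.Holds N mem env → b.Holds N mem env) := by
  simp only [imp, holds_neg, holds_add, not_and, not_not]

theorem holds_iff : (iff a b).Holds N mem env ↔ (a.Holds N mem env ↔ b.Holds N mem env) := by
  rw [iff, holds_add, holds_imp, holds_imp]
  exact iff_def.symm

theorem holds_sum : (sum x a).Holds N mem env ↔
    ∀ v : Fin N, a.Holds N mem (Function.update env x v) := by
  simp only [Holds, eval, Finset.sum_eq_zero_iff, Finset.mem_range, Fin.forall_iff]

theorem holds_ex : (ex x a).Holds N mem env ↔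
    ∃ v : Fin N, a.Holds N mem (Function.update env x v) := by
  simp only [ex, holds_neg, holds_sum, not_forall, not_not]

theorem holds_conj {m : ℕ} {f : Fin m → LoopExpr V} :
    (conj f).Holds N mem env ↔ ∀ j, (f j).Holds N mem env := by
  induction m with
  | zero => simp [conj, Holds, eval]
  | succ m ih =>
    rw [conj, List.ofFn_succ, List.foldr_cons, holds_add, ← conj, ih, Fin.forall_fin_succ]

end LoopExpr

namespace RobustnessTest

open LoopExpr LoopStmt

/-- The variables of the program. -/
inductive Var
  | agent
  | object
  /-- an object that is compared with `object` -/
  | rival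
  /-- the position of the better object in a comparison -/
  | betterRank
  /-- the position of the worse object in a comparison -/
  | worseRank
  | round
  | subround
  /-- the bound variable of sums that serve as products -/
  | index
  /-- the `j`-th agent of a closed walk -/
  | cycleAgent (j : ℕ)
  /-- the `j`-th object of a closed walk -/
  | cycleObject (j : ℕ)

namespace Var

/-- The number of a variable. -/
def code : Var → ℕ
  | agent => 0
  | object => 1
  | rival => 2
  | betterRank => 3
  | worseRank => 4
  | round => 5
  | subround => 6
  | index => 7
  | cycleAgent j => 8 + 2 * j
  | cycleObject j => 9 + 2 * j

theorem code_injective : Function.Injective code := by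
  intro x y h
  cases x <;> cases y <;> simp only [code] at h ⊢ <;> first | omega | (congr 1; omega)

noncomputable instance : Encodable Var := Encodable.ofInj code code_injective

noncomputable instance : DecidableEq Var := Encodable.decidableEqOfEncodable Var

end Var

open Var

/-- The square of the size. -/
def sq : LoopExpr Var := sum index size

/-- The size times `x`. -/
def scale (x : Var) : LoopExpr Var := sum index (var x)

/-- The object in position `r` of the list of agent `y`. -/
def prefEntry (y r : Var) : LoopExpr Var := load (add (const 1) (add (scale y) (var r)))

/-- The numerator of the entry `(agent, x)` of the random assignment. -/
def entry (x : Var) : LoopExpr Var :=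
  load (add (add (const 1) sq) (add (add (scale agent) (var x)) (add (scale agent) (var x))))

/-- The address of the result. -/
def resultCell : LoopExpr Var := add (const 1) (add (add sq sq) sq)

/-- The address of the price of the object `x`. -/
def priceCell (x : Var) : LoopExpr Var := add (add resultCell (const 1)) (add (var x) (var x))

/-- The address of the holder of the object `x`. Bidder `i` is recorded as `i + 1`, and `0` means
that nobody holds the object. -/
def holderCell (x : Var) : LoopExpr Var := add (add resultCell (const 2)) (add (var x) (var x))

/-- Agent `j` of the walk strictly prefers object `l` of the walk to object `l'`. -/
def prefers (j l l' : ℕ) : LoopExpr Var :=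
  ex betterRank <| ex worseRank <| add (lt (var betterRank) (var worseRank)) <|
    add (eq (prefEntry (cycleAgent j) betterRank) (var (cycleObject l)))
      (eq (prefEntry (cycleAgent j) worseRank) (var (cycleObject l')))

/-- Every agent of the walk with `m + 1` agents strictly prefers the next object to his own. -/
def closedWalk (m : ℕ) : LoopExpr Var :=
  conj fun j : Fin (m + 1) => prefers j ↑(j + 1) j

/-- The pair `(agent, x)` is in the support, and if it meets a pair of the walk with `m + 1` agents
then it is that pair. -/
def compatible (m : ℕ) (x : Var) : LoopExpr Var :=
  add (lt (const 0) (entry x)) <| conj fun j : Fin (m + 1) =>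
    iff (eq (var agent) (var (cycleAgent j))) (eq (var x) (var (cycleObject j)))

/-- In the auction, `agent` bids for `object`. -/
def bids (m : ℕ) : LoopExpr Var :=
  add (sum rival (neg (eq (load (holderCell rival)) (add (var agent) (const 1))))) <|
  add (compatible m object) <|
  sum rival (imp (compatible m rival) (le (load (priceCell object)) (load (priceCell rival))))

/-- Let `agent` bid for `object`. -/
def offer (m : ℕ) : LoopStmt Var :=
  guard (bids m) <| seq (store (holderCell object) (add (var agent) (const 1)))
    (store (priceCell object) (add (load (priceCell object)) (const 1)))

/-- One round of the auction. -/
def sweep (m : ℕ) : LoopStmt Var := forRange agent (forRange object (offer m))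

/-- Set all prices to `0` and take away all objects. -/
def reset : LoopStmt Var :=
  forRange object <| seq (store (priceCell object) (const 0)) (store (holderCell object) (const 0))

/-- The auction. -/
def auction (m : ℕ) : LoopStmt Var :=
  seq reset (forRange round (forRange subround (sweep m)))

/-- Every agent holds an object. -/
def served : LoopExpr Var :=
  sum agent (ex object (eq (load (holderCell object)) (add (var agent) (const 1))))

/-- Set the result to `0` if the walk is closed and extends to an assignment in the support. -/
def check (m : ℕ) : LoopStmt Var :=
  guard (closedWalk m) (seq (auction m) (guard served (store resultCell (const 0))))

/-- Run `b` for all walks with `m` agents. -/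
def forWalks : ℕ → LoopStmt Var → LoopStmt Var
  | 0, b => b
  | m + 1, b => forWalks m (forRange (cycleAgent m) (forRange (cycleObject m) b))

/-- Set the result to `1` if no walk with at most `k` agents passes the check, and to `0`
otherwise. -/
def test : ℕ → LoopStmt Var
  | 0 => store resultCell (const 1)
  | k + 1 => seq (test k) (forWalks (k + 1) (check k))

end RobustnessTest

/-! ## Correctness of the program -/

theorem foldl_product {α β σ : Type*} (f : σ → α × β → σ) (s : σ) (l : List α) (l' : List β) :
    (l ×ˢ l').foldl f s = l.foldl (fun s x => l'.foldl (fun s y => f s (x, y)) s) s := by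
  simp only [SProd.sprod, List.product, List.foldl_flatMap, List.foldl_map]

namespace LoopStmt

variable {V : Type*} [DecidableEq V] {N : ℕ} {env : V → ℕ} {mem : ℕ → ℕ} {b : LoopStmt V}

theorem exec_guard_of_holds {e : LoopExpr V} (h : e.Holds N mem env) :
    (guard e b).exec N env mem = b.exec N env mem := if_pos h

theorem exec_guard_of_not_holds {e : LoopExpr V} (h : ¬ e.Holds N mem env) :
    (guard e b).exec N env mem = mem := if_neg h

theorem exec_forRange_of_rel {σ : Type*} (R : σ → (ℕ → ℕ) → Prop) {f : σ → Fin N → σ} {x : V}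
    (hf : ∀ s mem (v : Fin N), R s mem → R (f s v) (b.exec N (Function.update env x v) mem))
    {s : σ} (hs : R s mem) :
    R ((List.finRange N).foldl f s) ((forRange x b).exec N env mem) := by
  rw [exec, ← List.map_coe_finRange_eq_range, List.foldl_map]
  exact List.foldl_rel hs fun v _ s mem => hf s mem v

theorem exec_forRange_of_rel_iterate {σ : Type*} (R : σ → (ℕ → ℕ) → Prop) {f : σ → σ} {x : V}
    (hf : ∀ s mem (v : Fin N), R s mem → R (f s) (b.exec N (Function.update env x v) mem))
    {s : σ} (hs : R s mem) : R (f^[N] s) ((forRange x b).exec N env mem) := by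
  simpa [List.foldl_const] using exec_forRange_of_rel R (f := fun s _ => f s) hf hs

end LoopStmt

namespace RobustnessTest

open LoopExpr LoopStmt Var

section Eval

variable {N : ℕ} {mem : ℕ → ℕ} {env : Var → ℕ} {x y : Var}

theorem eval_prefEntry (hy : y ≠ index) :
    (prefEntry y x).eval N mem env = mem (prefAddr N (env y) (env x)) := by
  simp [prefEntry, scale, eval, prefAddr, hy]

theorem eval_entry :
    (entry x).eval N mem env = mem (entryAddr N (env agent) (env x)) := by
  simp [entry, scale, sq, eval, entryAddr]

theorem eval_resultCell : resultCell.eval N mem env = resultAddr N := by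
  simp [resultCell, sq, eval, resultAddr]

theorem eval_priceCell :
    (priceCell x).eval N mem env = resultAddr N + 1 + (env x + env x) := by
  simp only [priceCell, eval, eval_resultCell]

theorem eval_holderCell :
    (holderCell x).eval N mem env = resultAddr N + 2 + (env x + env x) := by
  simp only [holderCell, eval, eval_resultCell]

end Eval

/-- The walk variables of `env` hold the agents `a` and the objects `o`. -/
def HoldsWalk {m n : ℕ} (a o : Fin m → Fin n) (env : Var → ℕ) : Prop :=
  ∀ j : Fin m, env (cycleAgent j) = a j ∧ env (cycleObject j) = o j

theorem HoldsWalk.snoc {m n : ℕ} {a o : Fin m → Fin n} {env : Var → ℕ} (h : HoldsWalk a o env)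
    (i x : Fin n) :
    HoldsWalk (Fin.snoc a i : Fin (m + 1) → Fin n) (Fin.snoc o x : Fin (m + 1) → Fin n)
      (Function.update (Function.update env (cycleAgent m) i) (cycleObject m) x) := by
  intro j
  induction j using Fin.lastCases with
  | last => simp
  | cast j => simpa [j.2.ne] using h j

/-- The record of the holder of an object in the memory. -/
def holderCode {n : ℕ} (h : Option (Fin n)) : ℕ := h.elim 0 fun i => i + 1

theorem holderCode_eq_succ_iff {n : ℕ} {h : Option (Fin n)} {i : Fin n} :
    holderCode h = i + 1 ↔ h = some i := by
  cases h <;> simp [holderCode, Fin.ext_iff]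

variable {I : AssignmentInstance} {m r : ℕ} {a o : Fin (m + 1) → Fin I.n} {env : Var → ℕ}
  {mem : ℕ → ℕ}

/-- The agent `i` and the object `x` can be matched in an assignment in the support of the random
assignment in which each agent `a j` receives `o j`. -/
def Compatible (I : AssignmentInstance) {m : ℕ} (a o : Fin (m + 1) → Fin I.n) (i x : Fin I.n) :
    Prop :=
  0 < I.realMatrix i x ∧ ∀ j, i = a j ↔ x = o j

/-- Besides the instance and the result, the memory holds a state of the auction. -/
structure HoldsAuction (I : AssignmentInstance) (r : ℕ) (s : AuctionState (Fin I.n) (Fin I.n))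
    (mem : ℕ → ℕ) : Prop where
  stored : I.Stored r mem
  price_eq : ∀ x : Fin I.n, mem (resultAddr I.n + 1 + (x + x)) = s.price x
  holder_eq : ∀ x : Fin I.n, mem (resultAddr I.n + 2 + (x + x)) = holderCode (s.holder x)

theorem holds_prefers (hmem : I.Stored r mem) (henv : HoldsWalk a o env) {j l l' : Fin (m + 1)} :
    (prefers j l l').Holds I.n mem env ↔ I.pref.Strict (a j) (o l) (o l') := by
  simp only [prefers, holds_ex, holds_add, holds_lt, holds_eq, eval, eval_prefEntry, ne_eq,
    reduceCtorEq, not_false_eq_true, Function.update_self, Function.update_of_ne, (henv _).1,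
    (henv _).2, hmem.prefAddr_eq, Fin.val_fin_lt, Fin.val_inj, Profile.Strict]
  exact ⟨fun ⟨v, w, hlt, hv, hw⟩ => by rwa [← hv, ← hw, Equiv.symm_apply_apply,
    Equiv.symm_apply_apply], fun hlt => ⟨_, _, hlt, Equiv.apply_symm_apply _ _,
    Equiv.apply_symm_apply _ _⟩⟩

theorem holds_closedWalk (hmem : I.Stored r mem) (henv : HoldsWalk a o env) :
    (closedWalk m).Holds I.n mem env ↔ ∀ j, I.pref.Strict (a j) (o (j + 1)) (o j) :=
  holds_conj.trans <| forall_congr' fun _ => holds_prefers hmem henv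

theorem holds_compatible (hmem : I.Stored r mem) (henv : HoldsWalk a o env) {i x : Fin I.n}
    {y : Var} (hi : env agent = i) (hx : env y = x) :
    (compatible m y).Holds I.n mem env ↔ Compatible I a o i x := by
  simp only [compatible, holds_add, holds_lt, holds_conj, holds_iff, holds_eq, eval,
    eval_entry, hi, hx, (henv _).1, (henv _).2, hmem.entryAddr_pos_iff, Fin.val_inj, Compatible]

theorem holds_bids {s : AuctionState (Fin I.n) (Fin I.n)} (hmem : HoldsAuction I r s mem)
    (henv : HoldsWalk a o env) {i x : Fin I.n} (hi : env agent = i) (hx : env object = x) :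
    (bids m).Holds I.n mem env ↔ s.Bids (Compatible I a o) i x := by
  have henv' : ∀ y : Fin I.n, HoldsWalk a o (Function.update env rival y) := fun y j => by
    simpa using henv j
  have hcompat : ∀ y : Fin I.n, (compatible m rival).Holds I.n mem (Function.update env rival y) ↔
      Compatible I a o i y := fun y =>
    holds_compatible hmem.stored (henv' y) (by simpa using hi) (by simp)
  simp only [bids, holds_add, holds_sum, holds_neg, holds_eq, holds_imp, holds_le, hcompat,
    holds_compatible hmem.stored henv hi hx, eval, eval_holderCell, eval_priceCell,
    ne_eq, reduceCtorEq, not_false_eq_true, Function.update_self, Function.update_of_ne, hi, hx,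
    hmem.price_eq, hmem.holder_eq, holderCode_eq_succ_iff, AuctionState.Bids]

theorem HoldsAuction.award {s : AuctionState (Fin I.n) (Fin I.n)} (hmem : HoldsAuction I r s mem)
    (i x : Fin I.n) :
    HoldsAuction I r (s.award i x) (Function.update
      (Function.update mem (resultAddr I.n + 2 + (x + x)) (i + 1))
      (resultAddr I.n + 1 + (x + x)) (s.price x + 1)) where
  stored := (hmem.stored.update (by omega) _).update (by omega) _
  price_eq y := by
    have := hmem.price_eq y
    simp only [AuctionState.award, Function.update_apply, Fin.ext_iff]
    grind
  holder_eq y := by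
    have := hmem.holder_eq y
    simp only [AuctionState.award, Function.update_apply, Fin.ext_iff]
    grind [holderCode]

theorem HoldsAuction.exec_offer {s : AuctionState (Fin I.n) (Fin I.n)}
    (hmem : HoldsAuction I r s mem) (henv : HoldsWalk a o env) {i x : Fin I.n}
    (hi : env agent = i) (hx : env object = x) :
    HoldsAuction I r (s.offer (Compatible I a o) (i, x)) ((offer m).exec I.n env mem) := by
  have hbids := holds_bids hmem henv hi hx
  rw [offer, AuctionState.offer]
  by_cases h : s.Bids (Compatible I a o) i x
  · rw [exec_guard_of_holds (hbids.mpr h), if_pos h]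
    have haward := hmem.award i x
    rw [← hmem.price_eq x] at haward
    simpa [exec, eval, eval_holderCell, eval_priceCell, hi, hx] using haward
  · rw [exec_guard_of_not_holds (mt hbids.mp h), if_neg h]
    exact hmem

theorem HoldsAuction.exec_sweep {s : AuctionState (Fin I.n) (Fin I.n)}
    (hmem : HoldsAuction I r s mem) (henv : HoldsWalk a o env) :
    HoldsAuction I r
      (AuctionState.sweep (Compatible I a o) (List.finRange I.n ×ˢ List.finRange I.n) s)
      ((sweep m).exec I.n env mem) := by
  rw [AuctionState.sweep, foldl_product]
  refine exec_forRange_of_rel (HoldsAuction I r) (fun s mem i hs => ?_) hmem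
  refine exec_forRange_of_rel (HoldsAuction I r) (fun s mem x hs => ?_) hs
  exact hs.exec_offer (fun j => by simpa using henv j) (by simp) (by simp)

theorem holdsAuction_exec_reset (hmem : I.Stored r mem) :
    HoldsAuction I r ⟨fun _ => 0, fun _ => none⟩ (reset.exec I.n env mem) := by
  have hcleared := exec_forRange_of_rel (env := env) (x := object)
    (b := seq (store (priceCell object) (const 0)) (store (holderCell object) (const 0)))
    (fun (l : List (Fin I.n)) mem => I.Stored r mem ∧ ∀ x ∈ l,
      mem (resultAddr I.n + 1 + (x + x)) = 0 ∧ mem (resultAddr I.n + 2 + (x + x)) = 0)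
    (f := fun l x => x :: l) (fun l mem x hl => ?_) (s := []) ⟨hmem, by simp⟩
  · rw [List.foldl_flip_cons_eq_append'] at hcleared
    exact ⟨hcleared.1, fun x => (hcleared.2 x (by simp)).1, fun x => (hcleared.2 x (by simp)).2⟩
  · simp only [exec, eval, eval_priceCell, eval_holderCell, Function.update_self]
    refine ⟨(hl.1.update (by omega) _).update (by omega) _, fun y hy => ?_⟩
    have := hl.2 y
    simp only [Function.update_apply, List.mem_cons] at hy ⊢
    grind

theorem holdsAuction_exec_auction (hmem : I.Stored r mem) (henv : HoldsWalk a o env) :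
    HoldsAuction I r
      (AuctionState.auction (Compatible I a o) (List.finRange I.n ×ˢ List.finRange I.n))
      ((auction m).exec I.n env mem) := by
  rw [AuctionState.auction, Fintype.card_fin, Function.iterate_mul]
  refine exec_forRange_of_rel_iterate (HoldsAuction I r) (fun s mem t hs => ?_)
    (holdsAuction_exec_reset hmem)
  exact exec_forRange_of_rel_iterate (HoldsAuction I r)
    (fun s mem u hs => hs.exec_sweep fun j => by simpa using henv j) hs

theorem holds_served {s : AuctionState (Fin I.n) (Fin I.n)} (hmem : HoldsAuction I r s mem) :
    served.Holds I.n mem env ↔ ∀ i, ∃ x, s.holder x = some i := by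
  simp [served, holds_sum, holds_ex, holds_eq, eval, eval_holderCell, hmem.holder_eq,
    holderCode_eq_succ_iff]

theorem exists_injective_compatible_iff {a o : Fin (m + 1) → Fin I.n} :
    (∃ g : Fin I.n → Fin I.n, Function.Injective g ∧ ∀ i, Compatible I a o i (g i)) ↔
      ∃ d : Equiv.Perm (Fin I.n), (∀ i, 0 < I.realMatrix i (d i)) ∧ ∀ j, d (a j) = o j := by
  constructor
  · rintro ⟨g, hg, hcompat⟩
    exact ⟨.ofBijective g (Finite.injective_iff_bijective.mp hg), fun i => (hcompat i).1,
      fun j => ((hcompat (a j)).2 j).mp rfl⟩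
  · rintro ⟨d, hd, hwalk⟩
    exact ⟨d, d.injective, fun i => ⟨hd i, fun j => by rw [← hwalk j, d.injective.eq_iff]⟩⟩

/-- The walk of the agents `a` and the objects `o` is closed and extends to an assignment in the
support: it witnesses that the random assignment is not robust ex post efficient. -/
def IsWitness (I : AssignmentInstance) {m : ℕ} (a o : Fin (m + 1) → Fin I.n) : Prop :=
  (∀ j, I.pref.Strict (a j) (o (j + 1)) (o j)) ∧
    ∃ d : Equiv.Perm (Fin I.n), (∀ i, 0 < I.realMatrix i (d i)) ∧ ∀ j, d (a j) = o j

open Classical in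
/-- The memory holds the instance, and the result is `0` if `Q` holds and `1` otherwise. -/
def HoldsVerdict (I : AssignmentInstance) (Q : Prop) (mem : ℕ → ℕ) : Prop :=
  I.Stored (if Q then 0 else 1) mem

/-- For walks with `m` agents, the statement `b` records in the verdict whether `P` holds. -/
def Refutes (I : AssignmentInstance) {m : ℕ} (b : LoopStmt Var)
    (P : (Fin m → Fin I.n) → (Fin m → Fin I.n) → Prop) : Prop :=
  ∀ ⦃a o env Q mem⦄, HoldsWalk a o env → HoldsVerdict I Q mem →
    HoldsVerdict I (Q ∨ P a o) (b.exec I.n env mem)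

theorem refutes_check (I : AssignmentInstance) (m : ℕ) :
    Refutes I (check m) (IsWitness I (m := m)) := by
  intro a o env Q mem henv hmem
  have hwalk := holds_closedWalk hmem henv
  have hauction := holdsAuction_exec_auction hmem henv
  have hserved := (holds_served (env := env) hauction).trans <|
    (AuctionState.forall_exists_holder_auction_iff (by simp)).trans exists_injective_compatible_iff
  by_cases hw : (closedWalk m).Holds I.n mem env
  · rw [check, exec_guard_of_holds hw, exec]
    by_cases hs : served.Holds I.n ((auction m).exec I.n env mem) env
    · rw [HoldsVerdict, if_pos (.inr ⟨hwalk.mp hw, hserved.mp hs⟩), exec_guard_of_holds hs, exec,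
        eval_resultCell]
      exact hauction.stored.update_result 0
    · rw [or_iff_left fun h => hs (hserved.mpr h.2), exec_guard_of_not_holds hs]
      exact hauction.stored
  · rwa [or_iff_left fun h => hw (hwalk.mpr h.1), check, exec_guard_of_not_holds hw]

theorem foldl_or_iff {α : Type*} (P : α → Prop) (l : List α) (Q : Prop) :
    l.foldl (fun Q x => Q ∨ P x) Q ↔ Q ∨ ∃ x ∈ l, P x := by
  induction l generalizing Q with
  | nil => simp
  | cons x l ih => rw [List.foldl_cons, ih, List.exists_mem_cons_iff, or_assoc]

theorem Refutes.congr {b : LoopStmt Var} {P Q : (Fin m → Fin I.n) → (Fin m → Fin I.n) → Prop}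
    (hb : Refutes I b P) (h : ∀ a o, P a o ↔ Q a o) : Refutes I b Q :=
  (funext₂ fun a o => propext (h a o) : P = Q) ▸ hb

theorem Refutes.forRange_forRange {b : LoopStmt Var}
    {P : (Fin (m + 1) → Fin I.n) → (Fin (m + 1) → Fin I.n) → Prop} (hb : Refutes I b P) :
    Refutes I (forRange (cycleAgent m) (forRange (cycleObject m) b)) fun a o =>
      ∃ i x, P (Fin.snoc a i) (Fin.snoc o x) := by
  intro a o env Q mem henv hmem
  have h := exec_forRange_of_rel (HoldsVerdict I) (x := cycleAgent m) (fun Q mem i hQ => by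
    exact exec_forRange_of_rel (HoldsVerdict I) (x := cycleObject m) (fun Q mem x hQ =>
      hb (henv.snoc i x) hQ) hQ) hmem
  simpa only [foldl_or_iff, List.mem_finRange, true_and] using h

theorem Refutes.forWalks {b : LoopStmt Var}
    {P : (Fin m → Fin I.n) → (Fin m → Fin I.n) → Prop} (hb : Refutes I b P) :
    Refutes I (m := 0) (forWalks m b) fun _ _ => ∃ a o, P a o := by
  induction m generalizing b with
  | zero =>
    exact hb.congr fun a o => ⟨fun h => ⟨a, o, h⟩, fun ⟨a', o', h⟩ =>
      Subsingleton.elim a' a ▸ Subsingleton.elim o' o ▸ h⟩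
  | succ m ih =>
    refine (ih hb.forRange_forRange).congr fun _ _ =>
      ⟨fun ⟨_, _, _, _, h⟩ => ⟨_, _, h⟩, fun ⟨a, o, h⟩ =>
        ⟨Fin.init a, Fin.init o, a (Fin.last m), o (Fin.last m), ?_⟩⟩
    rwa [Fin.snoc_init_self, Fin.snoc_init_self]

theorem holdsVerdict_exec_test (k : ℕ) (hmem : I.Stored r mem) :
    HoldsVerdict I (∃ m < k, ∃ a o : Fin (m + 1) → Fin I.n, IsWitness I a o)
      ((test k).exec I.n 0 mem) := by
  induction k with
  | zero => simpa [HoldsVerdict, test, exec, eval, eval_resultCell] using hmem.update_result 1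
  | succ k ih =>
    simpa only [Nat.exists_lt_succ_right, test, exec]
      using (refutes_check I k).forWalks (a := finZeroElim) (o := finZeroElim) finZeroElim ih

end RobustnessTest

theorem decidableInPolyTime_robustExPostEfficient (k : ℕ) :
    DecidableInPolyTime
      (fun I : {I : AssignmentInstance // I.pref.numTypes ≤ k} => I.1.encode)
      (fun I => RobustExPostEfficient I.1.pref I.1.realMatrix) := by
  classical
  refine decidableInPolyTime_of_loopStmt (RobustnessTest.test k)
    (.load RobustnessTest.resultCell) (fun I => I.1.size_le_inputSize) fun ⟨I, hI⟩ => ?_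
  have htest := (RobustnessTest.holdsVerdict_exec_test k
    (I := I) (mem := fun x => I.encode.getD x 0) ⟨fun _ _ => rfl, rfl⟩).result
  have hiff : (∃ m < k, ∃ a o : Fin (m + 1) → Fin I.n, RobustnessTest.IsWitness I a o) ↔
      ¬ RobustExPostEfficient I.pref I.realMatrix :=
    (not_robustExPostEfficient_iff_of_numTypes_le I.realMatrix_mem hI).symm
  rw [LoopExpr.eval, RobustnessTest.eval_resultCell]
  exact htest.trans (by simp only [hiff, ite_not])

theorem theorem11_general (k : ℕ) :
    DecidableInPolyTime
      (fun I : {I : AssignmentInstance // I.pref.numTypes ≤ k} => I.1.encode)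
      (fun I => RobustExPostEfficient I.1.pref I.1.realMatrix) ∧
    (∀ (n : ℕ) (pref : Profile n) (p : Matrix (Fin n) (Fin n) ℝ),
      p ∈ doublyStochastic ℝ (Fin n) →
      (RobustExPostEfficient pref p ↔
        ¬ ∃ c : TradingCycle pref p, c.Short ∧ c.RestMatchable)) ∧
    (∀ (n : ℕ) (pref : Profile n) (p : Matrix (Fin n) (Fin n) ℝ), pref.numTypes ≤ k →
      {c : TradingCycle pref p | c.Short}.encard ≤ ((k * n ^ (2 * k) : ℕ) : ℕ∞)) :=
  ⟨decidableInPolyTime_robustExPostEfficient k, fun _ _ _ hp => robustExPostEfficient_iff hp,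
    fun _ _ _ h => TradingCycle.encard_short_le h⟩

theorem theorem11 (k : ℕ) :
    -- polynomial-time decidability on the instances with at most `k` agent types
    DecidableInPolyTime
      (fun I : {I : AssignmentInstance // I.pref.numTypes ≤ k} => I.1.encode)
      (fun I => RobustExPostEfficient I.1.pref I.1.realMatrix) ∧
    -- the test through short trading cycles is correct
    (∀ (n : ℕ) (pref : Profile n) (p : Matrix (Fin n) (Fin n) ℝ),
      p ∈ doublyStochastic ℝ (Fin n) →
      (RobustExPostEfficient pref p ↔
        ¬ ∃ c : TradingCycle pref p, c.Short ∧ c.RestMatchable)) ∧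
    -- the number of short trading cycles is `O(n ^ (2 * k))`
    (∃ C : ℕ, ∀ (n : ℕ) (pref : Profile n) (p : Matrix (Fin n) (Fin n) ℝ),
      p ∈ doublyStochastic ℝ (Fin n) → pref.numTypes ≤ k →
      {c : TradingCycle pref p | c.Short}.encard ≤ ((C * n ^ (2 * k) : ℕ) : ℕ∞)) :=
  have ⟨hdec, htest, hcount⟩ := theorem11_general k
  ⟨hdec, htest, k, fun n pref p _ => hcount n pref p⟩
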